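/- **Setting.** Fix $\xi,\kappa,Pr,\lambda>0$ and two linearly independent horizontal periods, which generate a lattice in the $(x,y)$-plane; let $V$ be the period cell (period parallelogram) $\times\,(0,1)$, and let $\|\cdot\|$, $(\cdot,\cdot)$ be the norm and inner product of $L^2(V)$. Put $$f(z)=c_4(1-\cosh Az+c_3\sinh Az),\quad A=\tfrac1{\sqrt\kappa},\quad c_3=\frac{\cosh A-1}{\sinh A},\quad c_4=\frac{A}{A-2c_3}.$$ For $R\ge0$, perturbations $(\mathbf u,\theta)$ of the conduction state, with $\mathbf u=(u_1,u_2,u_3)$ and $w=u_3$, obey in $V$, with $\mathbf k=(0,0,1)$, $$\mathbf u_t+(\mathbf u\cdot\nabla)\mathbf u=-\nabla\pi+R\theta\mathbf k+\Delta\mathbf u-\xi\Delta^2\mathbf u,\qquad \operatorname{div}\mathbf u=0,$$ $$Pr(\theta_t+\mathbf u\cdot\nabla\theta)=f(z)Rw+\Delta\theta-\kappa\Delta^2\theta,$$ with periodicity in $(x,y)$ and $\mathbf u=\partial_z\mathbf u=0$, $\theta=\partial_z\theta=0$ on $z=0,1$. Let $H$ be the space of all $(\mathbf u,\theta)$ with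 components in $H^2(V)$, periodic in $(x,y)$, satisfying these boundary conditions, and with $\operatorname{div}\mathbf u=0$. (Concretely, the components belong to the closure in $H^2(V)$ of the smooth functions that are periodic in $(x,y)$ and vanish near $z=0$ and $z=1$.) A *solution* is a pair $(\mathbf u,\theta)$ that is continuous on $[0,\infty)$ and absolutely continuous on compact subsets of $(0,\infty)$ with values in $L^2(V)$, and that for a.e. $t>0$ lies in $H$, is differentiable in $L^2(V)$, and satisfies the equations in the dual of $H$: for all $(\mathbf v,\varphi)\in H$, $$(\mathbf u_t+(\mathbf u\cdot\nabla)\mathbf u,\mathbf v)=R(\theta,v_3)-(\nabla\mathbf u,\nabla\mathbf v)-\xi(\Delta\mathbf u,\Delta\mathbf v),$$ $$Pr(\theta_t+\mathbf u\cdot\nabla\theta,\varphi)=R(fw,\varphi)-(\nabla\theta,\nabla\varphi)-\kappa(\Delta\theta,\Delta\varphi).$$ Any initial datum in $L^2(V)$ is allowed. Define $$E=\tfrac12\|\mathbf u\|^2+\tfrac{\lambda Pr}{2}\|\theta\|^2,\qquad I=(\theta,w(1+\lambda f)),$$ $$D=\|\nabla\mathbf u\|^2+\xi\|\Delta\mathbf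 u\|^2+\lambda\|\nabla\theta\|^2+\lambda\kappa\|\Delta\theta\|^2,\qquad \frac1{R_E}=\sup_{H\setminus\{0\}}\frac ID .$$ **Theorem.** 1. $D>0$ on $H\setminus\{0\}$, $0<R_E<\infty$, and the supremum is attained by some nonzero element of $H$. 2. For every $R\ge0$ and every solution, for a.e. $t>0$ the derivative $dE/dt$ exists and $$\frac{dE}{dt}=RI-D\le-D\Bigl(1-\frac R{R_E}\Bigr).$$ 3. Let $0\le R<R_E$, $\gamma=1-R/R_E$ and $k=\min\{2\pi^2(1+\xi\pi^2),\tfrac{2\pi^2}{Pr}(1+\kappa\pi^2)\}$. Then for every solution $\frac{dE}{dt}\le-k\gamma E$ for a.e. $t>0$, and $$E(t)\le e^{-k\gamma t}E(0)\qquad\text{for all }t\ge0 .$$ Hence the conduction state is globally nonlinearly stable: for every $\varepsilon>0$ there is $\delta>0$ such that each solution with $(\|\mathbf u(0)\|^2+\|\theta(0)\|^2)^{1/2}<\delta$ satisfies $(\|\mathbf u(t)\|^2+\|\theta(t)\|^2)^{1/2}<\varepsilon$ for all $t\ge0$; and $\|\mathbf u(t)\|^2+\|\theta(t)\|^2\to0$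 as $t\to\infty$ for every solution, whatever the size of its initial datum. -/

import Mathlib

open MeasureTheory Filter Topology
open scoped ContDiff

namespace Convection

/-- Points `(x, y, z)` of the layer; `x 2` is the vertical coordinate `z`. -/
abbrev Point := Fin 3 → ℝ

/-- Two linearly independent horizontal periods, generating the lattice of a planform that tiles the
plane. -/
abbrev Periods := Module.Basis (Fin 2) ℝ (Fin 2 → ℝ)

/-- The horizontal vector `(a₀, a₁, 0)`. -/
def horiz (a : Fin 2 → ℝ) : Point := ![a 0, a 1, 0]

/-- The period cell `V`: a period parallelogram of the lattice times `0 < z < 1`. -/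
def cell (b : Periods) : Set Point :=
  {x | ![x 0, x 1] ∈ ZSpan.fundamentalDomain b ∧ x 2 ∈ Set.Ioo (0 : ℝ) 1}

/-- Lebesgue measure on the period cell. -/
noncomputable abbrev cellMeasure (b : Periods) : Measure Point := volume.restrict (cell b)

/-- The real Hilbert space `L²(V)`. -/
noncomputable abbrev L2 (b : Periods) := Lp ℝ 2 (cellMeasure b)

/-- The partial derivative `∂φ/∂xᵢ`. -/
noncomputable def pderiv (i : Fin 3) (φ : Point → ℝ) (x : Point) : ℝ :=
  fderiv ℝ φ x (Pi.single i 1)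

/-- Smooth functions, periodic in `(x, y)`, vanishing near and beyond the planes `z = 0` and
`z = 1`. -/
structure IsTest (b : Periods) (φ : Point → ℝ) : Prop where
  smooth : ContDiff ℝ ∞ φ
  periodic : ∀ (i : Fin 2) (x : Point), φ (x + horiz (b i)) = φ x
  support : ∃ lo hi : ℝ, 0 < lo ∧ hi < 1 ∧ ∀ x : Point, x 2 ∉ Set.Icc lo hi → φ x = 0

theorem IsTest.pderiv {b : Periods} {φ : Point → ℝ} (h : IsTest b φ) (i : Fin 3) :
    IsTest b (pderiv i φ) where
  smooth := by
    have : ContDiff ℝ ∞ (fderiv ℝ φ) := h.smooth.fderiv_right (by simp)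
    exact this.clm_apply contDiff_const
  periodic := by
    intro j x
    have h1 : (fun y => φ (y + horiz (b j))) = φ := funext (h.periodic j)
    have h2 := fderiv_comp_add_right (𝕜 := ℝ) (f := φ) (x := x) (horiz (b j))
    rw [h1] at h2
    simp only [Convection.pderiv, h2]
  support := by
    obtain ⟨lo, hi, h0, h1, hz⟩ := h.support
    refine ⟨lo, hi, h0, h1, fun x hx => ?_⟩
    have hopen : IsOpen {y : Point | y 2 ∉ Set.Icc lo hi} :=
      (isClosed_Icc.preimage (continuous_apply (2 : Fin 3))).isOpen_compl
    have hev : φ =ᶠ[𝓝 x] fun _ => (0 : ℝ) := by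
      filter_upwards [hopen.mem_nhds hx] with y hy using hz y hy
    simp [Convection.pderiv, hev.fderiv_eq]

theorem cell_bounded (b : Periods) : Bornology.IsBounded (cell b) := by
  obtain ⟨C, hC⟩ := (ZSpan.fundamentalDomain_isBounded b).exists_norm_le
  refine isBounded_iff_forall_norm_le.2 ⟨max C 1, fun x hx => ?_⟩
  have h1 := hC _ hx.1
  have h0 : 0 ≤ max C 1 := le_trans zero_le_one (le_max_right _ _)
  rw [pi_norm_le_iff_of_nonneg h0]
  intro i
  fin_cases i
  · exact ((norm_le_pi_norm (![x 0, x 1] : Fin 2 → ℝ) 0).trans h1).trans (le_max_left _ _)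
  · exact ((norm_le_pi_norm (![x 0, x 1] : Fin 2 → ℝ) 1).trans h1).trans (le_max_left _ _)
  · refine le_trans ?_ (le_max_right _ _)
    have h2 : 0 < x 2 ∧ x 2 < 1 := hx.2
    change ‖x 2‖ ≤ 1
    rw [Real.norm_eq_abs, abs_le]
    exact ⟨by linarith [h2.1], h2.2.le⟩

theorem cell_volume_lt_top (b : Periods) : volume (cell b) < ⊤ := (cell_bounded b).measure_lt_top

theorem cell_measurableSet (b : Periods) : MeasurableSet (cell b) := by
  have h1 : Measurable fun x : Point => (![x 0, x 1] : Fin 2 → ℝ) := by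
    refine measurable_pi_iff.2 fun i => ?_
    fin_cases i
    · exact measurable_pi_apply 0
    · exact measurable_pi_apply 1
  exact (h1 (ZSpan.fundamentalDomain_measurableSet b)).inter
    (measurableSet_Ioo.preimage (measurable_pi_apply 2))

theorem IsTest.memLp {b : Periods} {φ : Point → ℝ} (h : IsTest b φ) :
    MemLp φ 2 (cellMeasure b) := by
  have : IsFiniteMeasure (cellMeasure b) := ⟨by simpa using cell_volume_lt_top b⟩
  obtain ⟨C, hC⟩ := (cell_bounded b).isCompact_closure.exists_bound_of_continuousOn
    h.smooth.continuous.continuousOn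
  refine MemLp.of_bound h.smooth.continuous.aestronglyMeasurable C ?_
  filter_upwards [ae_restrict_mem (cell_measurableSet b)] with x hx
  exact hC x (subset_closure hx)

/-- The space of test functions. -/
def testSpace (b : Periods) : Submodule ℝ (Point → ℝ) where
  carrier := {φ | IsTest b φ}
  zero_mem' := ⟨contDiff_const, fun _ _ => rfl, 1 / 2, 1 / 2, by norm_num, by norm_num,
    fun _ _ => rfl⟩
  add_mem' := by
    rintro φ ψ ⟨hs, hp, l, u, hl, hu, hz⟩ ⟨hs', hp', l', u', hl', hu', hz'⟩
    refine ⟨hs.add hs', fun i x => by simp [hp i x, hp' i x], min l l', max u u',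
      lt_min hl hl', max_lt hu hu', fun x hx => ?_⟩
    have h1 : x 2 ∉ Set.Icc l u := fun h => hx ⟨(min_le_left _ _).trans h.1,
      h.2.trans (le_max_left _ _)⟩
    have h2 : x 2 ∉ Set.Icc l' u' := fun h => hx ⟨(min_le_right _ _).trans h.1,
      h.2.trans (le_max_right _ _)⟩
    simp [hz x h1, hz' x h2]
  smul_mem' := by
    rintro c φ ⟨hs, hp, l, u, hl, hu, hz⟩
    exact ⟨contDiff_const.smul hs, fun i x => by simp [hp i x], l, u, hl, hu,
      fun x hx => by simp [hz x hx]⟩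

/-- A scalar function together with its first and second derivatives, all in `L²(V)`. -/
abbrev Jet (b : Periods) := L2 b × (Fin 3 → L2 b) × (Fin 3 → Fin 3 → L2 b)

/-- The function of a jet. -/
def Jet.val {b : Periods} (J : Jet b) : L2 b := J.1

/-- The derivative `∂ᵢ` of a jet. -/
def Jet.d {b : Periods} (J : Jet b) (i : Fin 3) : L2 b := J.2.1 i

/-- The Laplacian of a jet. -/
noncomputable def Jet.lap {b : Periods} (J : Jet b) : L2 b := ∑ i, J.2.2 i i

/-- The jet `(φ, ∇φ, ∇²φ)` of a test function. -/
noncomputable def testJet (b : Periods) (φ : testSpace b) : Jet b :=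
  (φ.2.memLp.toLp φ.1,
    fun i => (φ.2.pderiv i).memLp.toLp (pderiv i φ.1),
    fun i j => ((φ.2.pderiv j).pderiv i).memLp.toLp (pderiv i (pderiv j φ.1)))

/-- The scalar space `H²(V)` with periodicity in `(x, y)` and with the conditions
`f = ∂f/∂n = 0` on `z = 0, 1`. As usual for `H²₀`, it is the closure of the test functions in the
norm of `H²(V)`; an element is a function listed with its weak derivatives of order at most two. -/
def H20 (b : Periods) : Set (Jet b) := closure (Set.range (testJet b))

/-- Pairs `(u, θ)` of a velocity and a temperature. -/
abbrev Field (b : Periods) := (Fin 3 → Jet b) × Jet b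

/-- The space `H` of admissible perturbations: all components in `H²`, periodic, subject to the
conditions of strong adherence, and `div u = 0`. -/
def H (b : Periods) : Set (Field b) :=
  {U | (∀ i, U.1 i ∈ H20 b) ∧ U.2 ∈ H20 b ∧ ∑ i, (U.1 i).d i = 0}

/-- The profile `f(z) = c₄ (1 - cosh Az + c₃ sinh Az)`, where `A = 1/√κ`,
`c₃ = (cosh A - 1)/sinh A` and `c₄ = A/(A - 2c₃)`. -/
noncomputable def profile (κ z : ℝ) : ℝ :=
  let A := 1 / √κ
  let c₃ := (Real.cosh A - 1) / Real.sinh A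
  let c₄ := A / (A - 2 * c₃)
  c₄ * (1 - Real.cosh (A * z) + c₃ * Real.sinh (A * z))

/-- The energy `E = ½ ‖u‖² + (lam Pr / 2) ‖θ‖²`. -/
noncomputable def energy {b : Periods} (Pr lam : ℝ) (U : Field b) : ℝ :=
  1 / 2 * ∑ i, ‖(U.1 i).val‖ ^ 2 + lam * Pr / 2 * ‖U.2.val‖ ^ 2

/-- The production term `I = (θ, w (1 + lam f))`, with `w` the vertical component of `u`. -/
noncomputable def production {b : Periods} (κ lam : ℝ) (U : Field b) : ℝ :=
  ∫ x in cell b, U.2.val x * ((U.1 2).val x * (1 + lam * profile κ (x 2)))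

/-- The dissipation `D = ‖∇u‖² + ξ ‖Δu‖² + lam ‖∇θ‖² + lam κ ‖Δθ‖²`. -/
noncomputable def dissipation {b : Periods} (ξ κ lam : ℝ) (U : Field b) : ℝ :=
  (∑ i, ∑ j, ‖(U.1 i).d j‖ ^ 2) + ξ * (∑ i, ‖(U.1 i).lap‖ ^ 2)
    + lam * (∑ j, ‖U.2.d j‖ ^ 2) + lam * κ * ‖U.2.lap‖ ^ 2

/-- The values of `I/D` on the nonzero elements of `H`. -/
def quotients (b : Periods) (ξ κ lam : ℝ) : Set ℝ :=
  {q | ∃ U ∈ H b, U ≠ 0 ∧ q = production κ lam U / dissipation ξ κ lam U}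

/-- The energy threshold `R_E`, defined by `1/R_E = sup_H I/D`. -/
noncomputable def RE (b : Periods) (ξ κ lam : ℝ) : ℝ := 1 / sSup (quotients b ξ κ lam)

/-- The rate `k = min {2π²(1 + ξπ²), (2π²/Pr)(1 + κπ²)}`. -/
noncomputable def decayRate (ξ κ Pr : ℝ) : ℝ :=
  min (2 * Real.pi ^ 2 * (1 + ξ * Real.pi ^ 2))
    (2 * Real.pi ^ 2 / Pr * (1 + κ * Real.pi ^ 2))

/-- The equations for a perturbation `U = (u, θ)` at one instant, given the time derivatives `ut`
and `θt`:
`uₜ + (u·∇)u = -∇π + Rθk + Δu - ξΔ²u`,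
`Pr (θₜ + u·∇θ) = f R w + Δθ - κΔ²θ`,
as identities between functionals on `H`. Here `⟨Δ²f, g⟩ = (Δf, Δg)` and `⟨Δf, g⟩ = -(∇f, ∇g)`;
the pressure gradient annihilates the solenoidal fields. -/
def PerturbationEquations {b : Periods} (ξ κ Pr R : ℝ) (U : Field b)
    (ut : Fin 3 → L2 b) (θt : L2 b) : Prop :=
  ∀ W ∈ H b,
    (∑ i, inner ℝ (ut i) (W.1 i).val
        + ∑ i, ∑ j, ∫ x in cell b, (U.1 j).val x * (U.1 i).d j x * (W.1 i).val x
      = R * inner ℝ U.2.val (W.1 2).val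
        - ∑ i, ∑ j, inner ℝ ((U.1 i).d j) ((W.1 i).d j)
        - ξ * ∑ i, inner ℝ (U.1 i).lap (W.1 i).lap) ∧
    (Pr * (inner ℝ θt W.2.val
        + ∑ j, ∫ x in cell b, (U.1 j).val x * U.2.d j x * W.2.val x)
      = R * (∫ x in cell b, profile κ (x 2) * (U.1 2).val x * W.2.val x)
        - ∑ j, inner ℝ (U.2.d j) (W.2.d j)
        - κ * inner ℝ U.2.lap W.2.lap)

/-- Strong solutions of the perturbation equations on `t ≥ 0`: `(u, θ)` is continuous on `[0, ∞)`
and absolutely continuous on compact subsets of `(0, ∞)` with values in `L²(V)`, and for almost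
every `t > 0` it belongs to `H`, is differentiable in `L²(V)`, and satisfies the equations.
Only `L²(V)` is required of the initial datum; derivatives in the jets of `U t` carry
information only at the times at which `U t ∈ H`. -/
structure IsSolution {b : Periods} (ξ κ Pr R : ℝ) (U : ℝ → Field b) : Prop where
  cont_u : ∀ i, ContinuousOn (fun t => ((U t).1 i).val) (Set.Ici 0)
  cont_θ : ContinuousOn (fun t => (U t).2.val) (Set.Ici 0)
  ac_u : ∀ i, ∀ s t : ℝ, 0 < s → s ≤ t →
    AbsolutelyContinuousOnInterval (fun τ => ((U τ).1 i).val) s t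
  ac_θ : ∀ s t : ℝ, 0 < s → s ≤ t →
    AbsolutelyContinuousOnInterval (fun τ => (U τ).2.val) s t
  admissible : ∀ᵐ t ∂volume.restrict (Set.Ioi (0 : ℝ)), U t ∈ H b
  equations : ∀ᵐ t ∂volume.restrict (Set.Ioi (0 : ℝ)), ∃ (ut : Fin 3 → L2 b) (θt : L2 b),
    (∀ i, HasDerivAt (fun τ => ((U τ).1 i).val) (ut i) t) ∧
    HasDerivAt (fun τ => (U τ).2.val) θt t ∧
    PerturbationEquations ξ κ Pr R (U t) ut θt

/-- The size `(‖u‖² + ‖θ‖²)^{1/2}` of a perturbation. -/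
noncomputable def size {b : Periods} (U : Field b) : ℝ :=
  √(∑ i, ‖(U.1 i).val‖ ^ 2 + ‖U.2.val‖ ^ 2)

/-- Global nonlinear stability of the conduction state, that is of the zero perturbation: it is
Lyapunov stable, and every perturbation, whatever its initial size, tends to zero. -/
def GloballyStable (b : Periods) (ξ κ Pr R : ℝ) : Prop :=
  (∀ ε > 0, ∃ δ > 0, ∀ U : ℝ → Field b, IsSolution ξ κ Pr R U → size (U 0) < δ →
    ∀ t ≥ 0, size (U t) < ε) ∧
  ∀ U : ℝ → Field b, IsSolution ξ κ Pr R U → Tendsto (fun t => size (U t)) atTop (𝓝 0)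

end Convection

/-!
For a perturbation that solves the equations, testing with the perturbation itself gives
`dE/dt = R I - D`: the pressure and the convective terms do no work. If `μ = 1/R_E` is the maximum
of `I/D`, then `I ≤ μ D`, so `dE/dt ≤ -(1 - R/R_E) D`; the Poincaré inequality `kE ≤ D` and
Grönwall's inequality give the decay of `E`, and `E` is equivalent to the square of the `L²` norm.

The analytic content lies in the space `H²` of the closed-up test functions.

* Integrals over the period cell are integrals over the column above the period parallelogram,
  which is a fundamental domain of the lattice of periods acting on space. They are invariant under
  translations of a periodic integrand, so derivatives of test functions have mean zero
  (`IsTest.integral_pderiv`); this is integration by parts.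
* The supremum of a test function is bounded by its `H²` norm (`exists_sup_bound`): Taylor's formula
  writes `φ(x)` as an integral of `r` times derivatives of order at most two along a ray `x + rω`,
  `0 < r < 1`, and averaging over `ω` in the cell costs only the integrable factor `r^(-3/2) r`.
* Two consequences follow. The embedding of `H²` in `L²` is compact (`exists_subseq_val`): point
  evaluations are bounded functionals, so weak convergence in `H²` implies bounded pointwise
  convergence. And `∫ f g φ` is continuous on `L² × L² × H²` (`tendsto_integral_triple`), so the
  identity `∫ u φ ∂ⱼφ = -½ ∫ ∂ⱼu φ²` passes from test functions to `H²`, and convection by a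
  solenoidal field drops out of the energy balance (`sum_integral_convection_eq_zero`).
* Integration by parts gives `‖∇²φ‖ = ‖Δφ‖`, hence `D` is coercive in `H²`
  (`dissipation_coercive`), and `‖∇φ‖² = -(Δφ, φ)`, which together with the sharp inequality
  `π ‖φ‖ ≤ ‖∂φ/∂z‖` (`IsTest.poincare`) yields `kE ≤ D` (`decayRate_mul_energy_le`).
* The maximum of `I/D` is attained by the direct method (`exists_max_quotient`). It is positive
  because of the perturbation built from a stream function in `exists_production_pos`.
-/

namespace Convection

open scoped Pointwise

/-! ### The lattice of periods and integration over a period column -/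

/-- The vertical column over the period parallelogram. -/
def column (b : Periods) : Set Point := {x | ![x 0, x 1] ∈ ZSpan.fundamentalDomain b}

/-- The embedding of horizontal vectors in space, as a linear map. -/
def horizHom : (Fin 2 → ℝ) →ₗ[ℝ] Point where
  toFun := horiz
  map_add' v w := by ext i; fin_cases i <;> simp [horiz]
  map_smul' c v := by ext i; fin_cases i <;> simp [horiz]

/-- The lattice of horizontal periods, as a group of translations of space. -/
def lattice (b : Periods) : AddSubgroup Point :=
  (Submodule.span ℤ (Set.range b)).toAddSubgroup.map horizHom.toAddMonoidHom

/-- Invariance under the lattice of periods. -/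
def IsPeriodic {E : Type*} (b : Periods) (F : Point → E) : Prop :=
  ∀ v ∈ lattice b, ∀ x, F (v + x) = F x

theorem mem_lattice {b : Periods} {v : Point} :
    v ∈ lattice b ↔ ∃ a ∈ Submodule.span ℤ (Set.range b), horiz a = v := by
  simp only [lattice, AddSubgroup.mem_map, Submodule.mem_toAddSubgroup]
  rfl

instance lattice_countable (b : Periods) : Countable (lattice b) := by
  have h : Countable (Submodule.span ℤ (Set.range b)) :=
    (inferInstance : Countable (Submodule.span ℤ (Set.range fun i => b i)))
  exact ((Set.countable_coe_iff.1 h).image horizHom).to_subtype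

theorem IsTest.isPeriodic {b : Periods} {φ : Point → ℝ} (h : IsTest b φ) : IsPeriodic b φ := by
  intro v hv
  obtain ⟨a, ha, rfl⟩ := mem_lattice.1 hv
  change ∀ x, φ (horizHom a + x) = φ x
  induction ha using Submodule.span_induction with
  | mem a ha =>
    obtain ⟨i, rfl⟩ := ha
    intro x
    rw [add_comm]
    exact h.periodic i x
  | zero => simp
  | add u w hu hw ihu ihw =>
    have ihu := ihu (mem_lattice.2 ⟨u, hu, rfl⟩)
    have ihw := ihw (mem_lattice.2 ⟨w, hw, rfl⟩)
    intro x
    rw [map_add, add_assoc, ihu, ihw]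
  | smul n u hu ihu =>
    have ihu := ihu (mem_lattice.2 ⟨u, hu, rfl⟩)
    intro x
    have hn : ∀ (n : ℕ) (x : Point), φ (n • horizHom u + x) = φ x := by
      intro n
      induction n with
      | zero => simp
      | succ n ih => intro x; rw [succ_nsmul, add_assoc, ih, ihu]
    rw [map_zsmul]
    rcases Int.eq_nat_or_neg n with ⟨m, rfl | rfl⟩
    · simpa using hn m x
    · have := hn m (-(m • horizHom u) + x)
      rw [add_neg_cancel_left] at this
      simpa using this.symm

theorem cons_vadd (a : Fin 2 → ℝ) (x : Point) :
    (![(horiz a + x) 0, (horiz a + x) 1] : Fin 2 → ℝ) = a + ![x 0, x 1] := by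
  ext i; fin_cases i <;> simp [horiz]

theorem measurableSet_column (b : Periods) : MeasurableSet (column b) := by
  have h1 : Measurable fun x : Point => (![x 0, x 1] : Fin 2 → ℝ) := by
    refine measurable_pi_iff.2 fun i => ?_
    fin_cases i
    · exact measurable_pi_apply 0
    · exact measurable_pi_apply 1
  exact h1 (ZSpan.fundamentalDomain_measurableSet b)

/-- Every horizontal translate of the column is a fundamental domain of the lattice of periods. -/
theorem isAddFundamentalDomain_column (b : Periods) (h : Point) :
    IsAddFundamentalDomain (lattice b) {x | x + h ∈ column b} (volume : Measure Point) := by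
  refine IsAddFundamentalDomain.mk' ?_ fun x => ?_
  · exact ((measurable_add_const h) (measurableSet_column b)).nullMeasurableSet
  · obtain ⟨v, hv, huniq⟩ :=
      ZSpan.exist_unique_vadd_mem_fundamentalDomain b (![(x + h) 0, (x + h) 1])
    refine ⟨⟨horiz v, mem_lattice.2 ⟨v, v.2, rfl⟩⟩, ?_, ?_⟩
    · change ![(horiz v + x + h) 0, (horiz v + x + h) 1] ∈ ZSpan.fundamentalDomain b
      rw [add_assoc, cons_vadd]
      exact hv
    · rintro ⟨g, hg⟩ hgx
      obtain ⟨a, ha, rfl⟩ := mem_lattice.1 hg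
      have h1 : ![(horiz a + x + h) 0, (horiz a + x + h) 1] ∈ ZSpan.fundamentalDomain b := hgx
      rw [add_assoc, cons_vadd] at h1
      have h2 := huniq ⟨a, ha⟩ h1
      have h3 : a = v := congrArg Subtype.val h2
      simp [h3]

theorem isAddFundamentalDomain_column_zero (b : Periods) :
    IsAddFundamentalDomain (lattice b) (column b) (volume : Measure Point) := by
  simpa using isAddFundamentalDomain_column b 0

theorem preimage_column (b : Periods) (h : Point) :
    (fun x => x + h) ⁻¹' {x | x + -h ∈ column b} = column b := by
  ext x; simp

/-- The integral of a periodic function over the column is invariant under translations. -/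
theorem integral_column_add {b : Periods} {F : Point → ℝ} (hF : IsPeriodic b F) (h : Point) :
    ∫ x in column b, F (x + h) = ∫ x in column b, F x := by
  have h1 := (measurePreserving_add_right (volume : Measure Point) h).setIntegral_preimage_emb
    (measurableEmbedding_addRight h) F {x | x + -h ∈ column b}
  rw [preimage_column] at h1
  rw [h1]
  exact (isAddFundamentalDomain_column b (-h)).setIntegral_eq
    (isAddFundamentalDomain_column_zero b) fun g x => hF g g.2 x

theorem integrableOn_column_add {b : Periods} {F : Point → ℝ} (hF : IsPeriodic b F) (h : Point)
    (hi : IntegrableOn F (column b)) : IntegrableOn (fun x => F (x + h)) (column b) := by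
  have h1 := (measurePreserving_add_right (volume : Measure Point) h).integrableOn_comp_preimage
    (measurableEmbedding_addRight h) (f := F) (s := {x | x + -h ∈ column b})
  rw [preimage_column] at h1
  refine h1.2 ?_
  exact ((isAddFundamentalDomain_column b (-h)).integrableOn_iff
    (isAddFundamentalDomain_column_zero b) fun g x => hF g g.2 x).2 hi

theorem cell_subset_column (b : Periods) : cell b ⊆ column b := fun _ h => h.1

/-! ### Test functions -/

theorem IsTest.eq_zero {b : Periods} {φ : Point → ℝ} (h : IsTest b φ) {x : Point}
    (hx : x 2 ∉ Set.Ioo (0 : ℝ) 1) : φ x = 0 := by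
  obtain ⟨lo, hi, h0, h1, hz⟩ := h.support
  exact hz x fun h2 => hx ⟨h0.trans_le h2.1, h2.2.trans_lt h1⟩

theorem IsTest.continuous {b : Periods} {φ : Point → ℝ} (h : IsTest b φ) : Continuous φ :=
  h.smooth.continuous

theorem IsTest.differentiable {b : Periods} {φ : Point → ℝ} (h : IsTest b φ) :
    Differentiable ℝ φ := h.smooth.differentiable (by simp)

theorem IsTest.mul {b : Periods} {φ ψ : Point → ℝ} (h : IsTest b φ) (h' : IsTest b ψ) :
    IsTest b (fun x => φ x * ψ x) where
  smooth := h.smooth.mul h'.smooth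
  periodic i x := by rw [h.periodic, h'.periodic]
  support := by
    obtain ⟨lo, hi, h0, h1, hz⟩ := h.support
    exact ⟨lo, hi, h0, h1, fun x hx => by rw [hz x hx, zero_mul]⟩

theorem IsTest.exists_bound {b : Periods} {φ : Point → ℝ} (h : IsTest b φ) :
    ∃ C, 0 ≤ C ∧ ∀ x, |φ x| ≤ C := by
  obtain ⟨C, hC⟩ := (cell_bounded b).isCompact_closure.exists_bound_of_continuousOn
    h.continuous.continuousOn
  refine ⟨max C 0, le_max_right _ _, fun x => ?_⟩
  by_cases hx : x 2 ∈ Set.Ioo (0 : ℝ) 1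
  · obtain ⟨v, hv, -⟩ := ZSpan.exist_unique_vadd_mem_fundamentalDomain b (![x 0, x 1])
    have h1 : horiz v + x ∈ cell b := by
      refine ⟨?_, ?_⟩
      · rw [cons_vadd]; exact hv
      · simpa [horiz] using hx
    have h2 := h.isPeriodic _ (mem_lattice.2 ⟨v, v.2, rfl⟩) x
    rw [← h2]
    exact (hC _ (subset_closure h1)).trans (le_max_left _ _)
  · rw [h.eq_zero hx]; simp

instance cellMeasure_finite (b : Periods) : IsFiniteMeasure (cellMeasure b) :=
  ⟨by simpa using cell_volume_lt_top b⟩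

theorem IsTest.integrableOn_cell {b : Periods} {φ : Point → ℝ} (h : IsTest b φ) :
    IntegrableOn φ (cell b) := h.memLp.integrable (by norm_num)

/-- For functions that vanish off the layer, integrals over the column and over the cell agree. -/
theorem setIntegral_column {b : Periods} {F : Point → ℝ}
    (hF : ∀ x, x 2 ∉ Set.Ioo (0 : ℝ) 1 → F x = 0) :
    ∫ x in column b, F x = ∫ x in cell b, F x := by
  refine (setIntegral_eq_of_subset_of_forall_sdiff_eq_zero (measurableSet_column b)
    (cell_subset_column b) fun x hx => ?_)
  exact hF x fun h => hx.2 ⟨hx.1, h⟩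

theorem integrableOn_column {b : Periods} {F : Point → ℝ}
    (hF : ∀ x, x 2 ∉ Set.Ioo (0 : ℝ) 1 → F x = 0) (hi : IntegrableOn F (cell b)) :
    IntegrableOn F (column b) :=
  hi.of_forall_sdiff_eq_zero (measurableSet_column b) fun x hx => hF x fun h => hx.2 ⟨hx.1, h⟩

theorem IsTest.hasDerivAt_line {b : Periods} {φ : Point → ℝ} (h : IsTest b φ) (i : Fin 3)
    (x : Point) (t : ℝ) : HasDerivAt (fun s : ℝ => φ (x + s • Pi.single i (1 : ℝ)))
      (Convection.pderiv i φ (x + t • Pi.single i (1 : ℝ))) t := by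
  have h1 : HasDerivAt (fun s : ℝ => x + s • (Pi.single i (1 : ℝ) : Point))
      (Pi.single i (1 : ℝ)) t := by
    simpa using ((hasDerivAt_id t).smul_const (Pi.single i (1 : ℝ) : Point)).const_add x
  exact ((h.differentiable _).hasFDerivAt).comp_hasDerivAt t h1

theorem slab_measure_lt_top (b : Periods) :
    volume (column b ∩ {x | x 2 ∈ Set.Icc (-2 : ℝ) 2}) < ⊤ := by
  obtain ⟨C, hC⟩ := (ZSpan.fundamentalDomain_isBounded b).exists_norm_le
  refine Bornology.IsBounded.measure_lt_top (isBounded_iff_forall_norm_le.2 ⟨max C 2, ?_⟩)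
  rintro x ⟨hx1, hx2⟩
  have h1 := hC _ hx1
  rw [pi_norm_le_iff_of_nonneg (le_trans zero_le_two (le_max_right _ _))]
  intro i
  fin_cases i
  · exact ((norm_le_pi_norm (![x 0, x 1] : Fin 2 → ℝ) 0).trans h1).trans (le_max_left _ _)
  · exact ((norm_le_pi_norm (![x 0, x 1] : Fin 2 → ℝ) 1).trans h1).trans (le_max_left _ _)
  · exact le_trans (abs_le.2 hx2) (le_max_right _ _)

/-- The derivatives of a test function have mean zero: the integral over the column of a
translate of the function does not depend on the translation. -/
theorem IsTest.integral_pderiv {b : Periods} {φ : Point → ℝ} (h : IsTest b φ) (i : Fin 3) :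
    ∫ x in cell b, Convection.pderiv i φ x = 0 := by
  obtain ⟨C, hC0, hC⟩ := (h.pderiv i).exists_bound
  set e : Point := Pi.single i (1 : ℝ) with he
  set s : Set Point := {x | x 2 ∈ Set.Icc (-2 : ℝ) 2} with hs
  have hsm : MeasurableSet s := measurableSet_Icc.preimage (measurable_pi_apply 2)
  have hcφ := h.continuous
  have hcd := (h.pderiv i).continuous
  have key := hasDerivAt_integral_of_dominated_loc_of_deriv_le
    (μ := volume.restrict (column b)) (F := fun (t : ℝ) x => φ (x + t • e))
    (F' := fun (t : ℝ) x => Convection.pderiv i φ (x + t • e)) (x₀ := (0 : ℝ))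
    (s := Metric.ball 0 1) (bound := s.indicator fun _ => C)
    (Metric.ball_mem_nhds _ one_pos) ?_ ?_ ?_ ?_ ?_ ?_
  · have h1 : (fun t : ℝ => ∫ x in column b, φ (x + t • e)) =
        fun _ => ∫ x in column b, φ x :=
      funext fun t => integral_column_add h.isPeriodic (t • e)
    have h2 := key.2
    rw [h1] at h2
    have h3 := h2.unique (hasDerivAt_const _ _)
    simp only [zero_smul, add_zero] at h3
    rw [← setIntegral_column fun x hx => (h.pderiv i).eq_zero hx]
    exact h3
  · refine Eventually.of_forall fun t => Continuous.aestronglyMeasurable ?_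
    fun_prop
  · simp only [zero_smul, add_zero]
    exact integrableOn_column (fun x hx => h.eq_zero hx) h.integrableOn_cell
  · refine Continuous.aestronglyMeasurable ?_
    fun_prop
  · refine Eventually.of_forall fun x t ht => ?_
    by_cases hx : x ∈ s
    · rw [Set.indicator_of_mem hx]
      exact hC _
    · rw [Set.indicator_of_notMem hx, (h.pderiv i).eq_zero, norm_zero]
      intro hz
      apply hx
      have ht' : |t| < 1 := by simpa using ht
      have he2 : |e 2| ≤ 1 := by
        rw [he]; by_cases hi : (2 : Fin 3) = i
        · rw [← hi]; simp
        · rw [Pi.single_eq_of_ne hi]; simp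
      have h4 : |t * e 2| ≤ 1 := by
        rw [abs_mul]; nlinarith [abs_nonneg t, abs_nonneg (e 2)]
      have h5 : (0 : ℝ) < x 2 + t * e 2 ∧ x 2 + t * e 2 < 1 := by simpa using hz
      have h6 := abs_le.1 h4
      exact ⟨by linarith, by linarith⟩
  · rw [integrable_indicator_iff hsm]
    refine integrableOn_const ?_
    rw [Measure.restrict_apply hsm, Set.inter_comm]
    exact (slab_measure_lt_top b).ne
  · exact Eventually.of_forall fun x t _ => h.hasDerivAt_line i x t

theorem pderiv_mul {φ ψ : Point → ℝ} {x : Point} (hφ : DifferentiableAt ℝ φ x)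
    (hψ : DifferentiableAt ℝ ψ x) (i : Fin 3) :
    pderiv i (fun y => φ y * ψ y) x = pderiv i φ x * ψ x + φ x * pderiv i ψ x := by
  simp only [pderiv]
  rw [fderiv_fun_mul hφ hψ]
  simp
  ring

/-- Integration by parts on the period cell. -/
theorem IsTest.integral_mul_pderiv {b : Periods} {φ ψ : Point → ℝ} (h : IsTest b φ)
    (h' : IsTest b ψ) (i : Fin 3) :
    ∫ x in cell b, φ x * Convection.pderiv i ψ x
      = -∫ x in cell b, Convection.pderiv i φ x * ψ x := by
  have h1 := (h.mul h').integral_pderiv i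
  have h2 : (Convection.pderiv i fun x => φ x * ψ x) =
      fun x => Convection.pderiv i φ x * ψ x + φ x * Convection.pderiv i ψ x :=
    funext fun x => pderiv_mul (h.differentiable x) (h'.differentiable x) i
  rw [h2, integral_add ((h.pderiv i).mul h').integrableOn_cell
    (h.mul (h'.pderiv i)).integrableOn_cell] at h1
  linarith

/-! ### The uniform bound of test functions by their `H²` norm -/

theorem inner_toLp {b : Periods} {f g : Point → ℝ} (hf : MemLp f 2 (cellMeasure b))
    (hg : MemLp g 2 (cellMeasure b)) :
    inner ℝ (hf.toLp f) (hg.toLp g) = ∫ x in cell b, f x * g x := by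
  rw [L2.inner_def]
  refine integral_congr_ae ?_
  filter_upwards [hf.coeFn_toLp, hg.coeFn_toLp] with x hx hy
  rw [hx, hy]
  simp [mul_comm]

theorem norm_toLp_sq {b : Periods} {f : Point → ℝ} (hf : MemLp f 2 (cellMeasure b)) :
    ‖hf.toLp f‖ ^ 2 = ∫ x in cell b, f x ^ 2 := by
  rw [← real_inner_self_eq_norm_sq, inner_toLp]
  simp only [sq]

theorem fderiv_apply_eq_sum (φ : Point → ℝ) (y w : Point) :
    fderiv ℝ φ y w = ∑ i, w i * pderiv i φ y := by
  conv_lhs => rw [pi_eq_sum_univ' w]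
  simp only [map_sum, map_smul, pderiv, smul_eq_mul]

theorem IsTest.hasDerivAt_ray {b : Periods} {φ : Point → ℝ} (h : IsTest b φ)
    (x w : Point) (t : ℝ) : HasDerivAt (fun s : ℝ => φ (x + s • w))
      (∑ i, w i * Convection.pderiv i φ (x + t • w)) t := by
  have h1 : HasDerivAt (fun s : ℝ => x + s • w) w t := by
    simpa using ((hasDerivAt_id t).smul_const w).const_add x
  rw [← fderiv_apply_eq_sum]
  exact ((h.differentiable _).hasFDerivAt).comp_hasDerivAt t h1

/-- Taylor's formula at `0` for `(1 - r)² h(r)`, a function with a double zero at `1`. -/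
theorem eq_integral_second_deriv {h h' h'' : ℝ → ℝ} (h1 : ∀ t, HasDerivAt h (h' t) t)
    (h2 : ∀ t, HasDerivAt h' (h'' t) t) (hc : Continuous h'') :
    h 0 = ∫ r in (0 : ℝ)..1, r * (2 * h r - 4 * (1 - r) * h' r + (1 - r) ^ 2 * h'' r) := by
  have c1 : Continuous h := continuous_iff_continuousAt.2 fun t => (h1 t).continuousAt
  have c2 : Continuous h' := continuous_iff_continuousAt.2 fun t => (h2 t).continuousAt
  have hd : ∀ r : ℝ, HasDerivAt
      (fun r => r * (-2 * (1 - r) * h r + (1 - r) ^ 2 * h' r) - (1 - r) ^ 2 * h r)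
      (r * (2 * h r - 4 * (1 - r) * h' r + (1 - r) ^ 2 * h'' r)) r := by
    intro r
    have e1 : HasDerivAt (fun r : ℝ => 1 - r) (-1) r := by
      simpa using (hasDerivAt_id r).const_sub 1
    have e2 : HasDerivAt (fun r : ℝ => (1 - r) ^ 2) (2 * (1 - r) * (-1)) r := by
      simpa using e1.fun_pow 2
    have := ((hasDerivAt_id r).mul (((e1.const_mul (-2)).mul (h1 r)).add (e2.mul (h2 r)))).sub
      (e2.mul (h1 r))
    refine this.congr_deriv ?_
    simp only [Pi.add_apply, Pi.mul_apply, id]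
    ring
  rw [intervalIntegral.integral_eq_sub_of_hasDerivAt (fun r _ => hd r)
    (Continuous.intervalIntegrable (by fun_prop) _ _)]
  simp

/-- The sum of the absolute values of all derivatives of order at most two. -/
noncomputable def jetAbs (φ : Point → ℝ) (y : Point) : ℝ :=
  |φ y| + ∑ i, |pderiv i φ y| + ∑ i, ∑ j, |pderiv i (pderiv j φ) y|

theorem jetAbs_nonneg (φ : Point → ℝ) (y : Point) : 0 ≤ jetAbs φ y := by
  unfold jetAbs; positivity

theorem IsTest.continuous_jetAbs {b : Periods} {φ : Point → ℝ} (h : IsTest b φ) :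
    Continuous (jetAbs φ) := by
  have c0 := h.continuous
  have c1 := fun i => (h.pderiv i).continuous
  have c2 := fun i j => ((h.pderiv j).pderiv i).continuous
  unfold jetAbs
  fun_prop

/-- A pointwise bound by the derivatives of order at most two along the segment from `x` to
`x + w`. The formula holds for every direction `w`, which leaves `w` free for averaging. -/
theorem IsTest.abs_le_integral_ray {b : Periods} {φ : Point → ℝ} (h : IsTest b φ) {M : ℝ}
    (hM : 1 ≤ M) (x w : Point) (hw : ∀ i, |w i| ≤ M) :
    |φ x| ≤ ∫ r in (0 : ℝ)..1, r * (4 * M ^ 2 * jetAbs φ (x + r • w)) := by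
  have hj := h.continuous_jetAbs
  have c0 := h.continuous
  have c1 := fun i => (h.pderiv i).continuous
  have c2 := fun i j => ((h.pderiv j).pderiv i).continuous
  have key := eq_integral_second_deriv
    (h := fun r => φ (x + r • w))
    (h' := fun r => ∑ j, w j * Convection.pderiv j φ (x + r • w))
    (h'' := fun r => ∑ j, w j * ∑ i, w i * Convection.pderiv i (Convection.pderiv j φ) (x + r • w))
    (fun t => h.hasDerivAt_ray x w t)
    (fun t => HasDerivAt.fun_sum fun j _ => ((h.pderiv j).hasDerivAt_ray x w t).const_mul (w j))
    (by fun_prop)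
  simp only [zero_smul, add_zero] at key
  rw [key]
  refine (intervalIntegral.abs_integral_le_integral_abs zero_le_one).trans ?_
  refine intervalIntegral.integral_mono_on zero_le_one
    (Continuous.intervalIntegrable (by fun_prop) _ _)
    (Continuous.intervalIntegrable (by fun_prop) _ _) fun r hr => ?_
  rw [abs_mul, abs_of_nonneg hr.1]
  refine mul_le_mul_of_nonneg_left ?_ hr.1
  set y := x + r • w
  have b1 : |∑ j, w j * Convection.pderiv j φ y| ≤ M * ∑ j, |Convection.pderiv j φ y| := by
    rw [Finset.mul_sum]
    refine (Finset.abs_sum_le_sum_abs _ _).trans (Finset.sum_le_sum fun j _ => ?_)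
    rw [abs_mul]
    exact mul_le_mul_of_nonneg_right (hw j) (abs_nonneg _)
  have b2 : |∑ j, w j * ∑ i, w i * Convection.pderiv i (Convection.pderiv j φ) y| ≤
      M ^ 2 * ∑ i, ∑ j, |Convection.pderiv i (Convection.pderiv j φ) y| := by
    rw [Finset.sum_comm, Finset.mul_sum]
    refine (Finset.abs_sum_le_sum_abs _ _).trans (Finset.sum_le_sum fun j _ => ?_)
    rw [abs_mul, sq, mul_assoc]
    refine mul_le_mul (hw j) ?_ (abs_nonneg _) (by linarith)
    rw [Finset.mul_sum]
    refine (Finset.abs_sum_le_sum_abs _ _).trans (Finset.sum_le_sum fun i _ => ?_)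
    rw [abs_mul]
    exact mul_le_mul_of_nonneg_right (hw i) (abs_nonneg _)
  have p1 : 0 ≤ ∑ j, |Convection.pderiv j φ y| := by positivity
  have p2 : 0 ≤ ∑ i, ∑ j, |Convection.pderiv i (Convection.pderiv j φ) y| := by positivity
  have hr1 : |1 - r| ≤ 1 := abs_le.2 ⟨by linarith [hr.2], by linarith [hr.1]⟩
  have hr2 : (1 - r) ^ 2 ≤ 1 := by rw [← sq_abs]; nlinarith [abs_nonneg (1 - r)]
  have hM2 : M ≤ M ^ 2 := by nlinarith
  calc |2 * φ y - 4 * (1 - r) * (∑ j, w j * Convection.pderiv j φ y) + (1 - r) ^ 2 *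
        ∑ j, w j * ∑ i, w i * Convection.pderiv i (Convection.pderiv j φ) y|
      ≤ 2 * |φ y| + 4 * |1 - r| * |∑ j, w j * Convection.pderiv j φ y| + (1 - r) ^ 2 *
        |∑ j, w j * ∑ i, w i * Convection.pderiv i (Convection.pderiv j φ) y| := by
        refine (abs_add_le _ _).trans (add_le_add ((abs_sub _ _).trans ?_) ?_)
        · simp [abs_mul]
        · simp [abs_mul]
    _ ≤ 2 * |φ y| + 4 * 1 * (M * ∑ j, |Convection.pderiv j φ y|) + 1 *
        (M ^ 2 * ∑ i, ∑ j, |Convection.pderiv i (Convection.pderiv j φ) y|) := by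
        gcongr
    _ ≤ 4 * M ^ 2 * jetAbs φ y := by
        unfold jetAbs
        have q0 : |φ y| ≤ M ^ 2 * |φ y| := by nlinarith [abs_nonneg (φ y)]
        have q1 := mul_le_mul_of_nonneg_right hM2 p1
        have q2 := mul_nonneg (sq_nonneg M) p2
        nlinarith [abs_nonneg (φ y)]

theorem smul_mem_cell {b : Periods} {x : Point} (hx : x ∈ cell b) {r : ℝ} (h0 : 0 < r)
    (h1 : r ≤ 1) : r • x ∈ cell b := by
  refine ⟨?_, ?_⟩
  · have e : (![(r • x) 0, (r • x) 1] : Fin 2 → ℝ) = r • ![x 0, x 1] := by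
      ext i; fin_cases i <;> simp
    rw [e, ZSpan.mem_fundamentalDomain]
    intro i
    have h2 := ZSpan.mem_fundamentalDomain b |>.1 hx.1 i
    simp only [map_smul, Finsupp.smul_apply, smul_eq_mul]
    exact ⟨mul_nonneg h0.le h2.1, lt_of_le_of_lt (mul_le_of_le_one_left h2.1 h1) h2.2⟩
  · have h2 : 0 < x 2 ∧ x 2 < 1 := hx.2
    have e : (r • x) 2 = r * x 2 := by simp
    rw [e]
    exact ⟨mul_pos h0 h2.1, lt_of_le_of_lt (mul_le_of_le_one_left h2.1.le h1) h2.2⟩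

theorem cell_volume_pos (b : Periods) : 0 < volume (cell b) := by
  have hcr : Continuous b.equivFun := b.equivFun.toLinearMap.continuous_of_finiteDimensional
  have hch : Continuous fun x : Point => (![x 0, x 1] : Fin 2 → ℝ) := by
    refine continuous_pi fun i => ?_
    fin_cases i
    · exact continuous_apply 0
    · exact continuous_apply 1
  set s : Set Point := (fun x : Point => b.equivFun ![x 0, x 1]) ⁻¹'
      (Set.univ.pi fun _ => Set.Ioo (0 : ℝ) 1) ∩ (fun x : Point => x 2) ⁻¹' Set.Ioo (0 : ℝ) 1
    with hs
  have hopen : IsOpen s :=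
    ((isOpen_set_pi Set.finite_univ fun _ _ => isOpen_Ioo).preimage (hcr.comp hch)).inter
      (isOpen_Ioo.preimage (continuous_apply 2))
  have hsub : s ⊆ cell b := by
    rintro x ⟨hx, hz⟩
    refine ⟨(ZSpan.mem_fundamentalDomain b).2 fun i => ?_, hz⟩
    exact Set.Ioo_subset_Ico_self (hx i trivial)
  set c : Fin 2 → ℝ := b.equivFun.symm fun _ => 1 / 2 with hc
  have hne : s.Nonempty := by
    refine ⟨![c 0, c 1, 1 / 2], ?_, ?_⟩
    · have e : (![(![c 0, c 1, 1 / 2] : Point) 0, (![c 0, c 1, 1 / 2] : Point) 1] :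
          Fin 2 → ℝ) = c := by
        ext i; fin_cases i <;> simp
      rw [Set.mem_preimage, e, hc, LinearEquiv.apply_symm_apply]
      intro i _
      norm_num
    · change (0 : ℝ) < 1 / 2 ∧ (1 / 2 : ℝ) < 1
      norm_num
  exact (hopen.measure_pos volume hne).trans_le (measure_mono hsub)

/-- The Cauchy-Schwarz inequality against the constant `1`. -/
theorem integral_abs_le_sqrt {α : Type*} [MeasurableSpace α] {μ : Measure α} [IsFiniteMeasure μ]
    {f : α → ℝ} (hf : MemLp f 2 μ) :
    ∫ x, |f x| ∂μ ≤ √(μ.real Set.univ) * √(∫ x, f x ^ 2 ∂μ) := by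
  have hi : Integrable f μ := hf.integrable (by norm_num)
  have h2 : Integrable (fun x => f x ^ 2) μ := hf.integrable_sq
  set m := ∫ x, |f x| ∂μ with hm
  set v := μ.real Set.univ with hv
  have hm0 : 0 ≤ m := integral_nonneg fun x => abs_nonneg _
  have hv0 : 0 ≤ v := measureReal_nonneg
  have key : 0 ≤ v ^ 2 * ∫ x, f x ^ 2 ∂μ - v * m ^ 2 := by
    have h3 : 0 ≤ ∫ x, (v * |f x| - m) ^ 2 ∂μ := integral_nonneg fun x => sq_nonneg _
    have h4 : ∫ x, (v * |f x| - m) ^ 2 ∂μ = v ^ 2 * ∫ x, f x ^ 2 ∂μ - v * m ^ 2 := by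
      have h5 : ∀ x, (v * |f x| - m) ^ 2 = v ^ 2 * f x ^ 2 - 2 * v * m * |f x| + m ^ 2 := by
        intro x; rw [← sq_abs (f x)]; ring
      simp only [h5]
      rw [integral_add (f := fun x => v ^ 2 * f x ^ 2 - 2 * v * m * |f x|)
          ((h2.const_mul _).sub (hi.abs.const_mul _)) (integrable_const _),
        integral_sub (h2.const_mul _) (hi.abs.const_mul _), integral_const_mul,
        integral_const_mul, integral_const, ← hm, ← hv]
      simp; ring
    linarith
  rw [← Real.sqrt_mul hv0]
  refine Real.le_sqrt_of_sq_le ?_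
  rcases hv0.eq_or_lt with h0 | h0
  · have : μ = 0 := by
      have := (measureReal_eq_zero_iff (μ := μ) (s := Set.univ)).1 h0.symm
      exact Measure.measure_univ_eq_zero.1 this
    rw [hm, this]; simp
  · nlinarith

/-- The mean of a test function over a small copy `x + r V` of the cell. The scaled cell stays
inside a fundamental domain, so that only the power of `r` is lost. -/
theorem IsTest.integral_abs_add_smul_le {b : Periods} {F : Point → ℝ} (h : IsTest b F) (x : Point)
    {r : ℝ} (h0 : 0 < r) (h1 : r ≤ 1) :
    ∫ w in cell b, |F (x + r • w)| ≤
      r ^ (-(3 / 2) : ℝ) * (√(volume.real (cell b)) * ‖h.memLp.toLp F‖) := by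
  have hc := h.continuous
  obtain ⟨C, hC0, hC⟩ := h.exists_bound
  have hm : MemLp (fun w => F (x + r • w)) 2 (cellMeasure b) := by
    refine MemLp.of_bound (Continuous.aestronglyMeasurable (by fun_prop)) C ?_
    exact Eventually.of_forall fun w => hC _
  refine (integral_abs_le_sqrt hm).trans ?_
  have hsq : ∫ w in cell b, F (x + r • w) ^ 2 ≤ r ^ (-3 : ℝ) * ‖h.memLp.toLp F‖ ^ 2 := by
    have e1 := Measure.setIntegral_comp_smul_of_pos (volume : Measure Point)
      (fun y => F (x + y) ^ 2) (cell b) h0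
    rw [e1]
    simp only [Module.finrank_fintype_fun_eq_card, Fintype.card_fin, smul_eq_mul]
    rw [show (r ^ 3)⁻¹ = r ^ (-3 : ℝ) by
      rw [Real.rpow_neg h0.le]; norm_cast]
    refine mul_le_mul_of_nonneg_left ?_ (by positivity)
    have hper : IsPeriodic b fun y => F y ^ 2 := fun v hv y => by
      simp only [h.isPeriodic v hv y]
    have hz : ∀ y : Point, y 2 ∉ Set.Ioo (0 : ℝ) 1 → F y ^ 2 = 0 := fun y hy => by
      rw [h.eq_zero hy]; simp
    have hint : IntegrableOn (fun y => F y ^ 2) (column b) :=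
      integrableOn_column hz h.memLp.integrable_sq
    have hint' := integrableOn_column_add hper x hint
    calc ∫ y in r • cell b, F (x + y) ^ 2 ≤ ∫ y in column b, F (x + y) ^ 2 := by
          refine setIntegral_mono_set ?_ ?_ ?_
          · simpa only [add_comm] using hint'
          · exact Eventually.of_forall fun y => sq_nonneg _
          · refine LE.le.eventuallyLE ?_
            rintro _ ⟨y, hy, rfl⟩
            exact (smul_mem_cell hy h0 h1).1
      _ = ∫ y in column b, F y ^ 2 := by
          rw [← integral_column_add hper x]
          simp only [add_comm]
      _ = ‖h.memLp.toLp F‖ ^ 2 := by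
          rw [norm_toLp_sq, setIntegral_column hz]
  have e2 : √(r ^ (-3 : ℝ) * ‖h.memLp.toLp F‖ ^ 2) =
      r ^ (-(3 / 2) : ℝ) * ‖h.memLp.toLp F‖ := by
    rw [Real.sqrt_mul (by positivity), Real.sqrt_sq (norm_nonneg _), Real.sqrt_eq_rpow,
      ← Real.rpow_mul h0.le]
    norm_num
  have e3 : (cellMeasure b).real Set.univ = volume.real (cell b) := by
    simp [measureReal_def]
  rw [e3]
  calc √(volume.real (cell b)) * √(∫ w in cell b, F (x + r • w) ^ 2)
      ≤ √(volume.real (cell b)) * (r ^ (-(3 / 2) : ℝ) * ‖h.memLp.toLp F‖) := by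
        rw [← e2]; gcongr
    _ = _ := by ring

theorem IsTest.lintegral_abs_add_smul_le {b : Periods} {F : Point → ℝ} (h : IsTest b F)
    (x : Point) {r : ℝ} (h0 : 0 < r) (h1 : r ≤ 1) :
    ∫⁻ w in cell b, ENNReal.ofReal |F (x + r • w)| ≤
      ENNReal.ofReal (r ^ (-(3 / 2) : ℝ) * (√(volume.real (cell b)) * ‖h.memLp.toLp F‖)) := by
  have hc := h.continuous
  obtain ⟨C, hC0, hC⟩ := h.exists_bound
  rw [← ofReal_integral_eq_lintegral_ofReal]
  · exact ENNReal.ofReal_le_ofReal (h.integral_abs_add_smul_le x h0 h1)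
  · refine Integrable.of_bound (Continuous.aestronglyMeasurable (by fun_prop)) C ?_
    exact Eventually.of_forall fun w => by simpa using hC _
  · exact Eventually.of_forall fun w => abs_nonneg _

theorem norm_testJet_val {b : Periods} (φ : testSpace b) :
    ‖φ.2.memLp.toLp φ.1‖ ≤ ‖testJet b φ‖ := norm_fst_le (testJet b φ)

theorem norm_testJet_d {b : Periods} (φ : testSpace b) (i : Fin 3) :
    ‖(φ.2.pderiv i).memLp.toLp (pderiv i φ.1)‖ ≤ ‖testJet b φ‖ :=
  (norm_le_pi_norm (testJet b φ).2.1 i).trans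
    ((norm_fst_le (testJet b φ).2).trans (norm_snd_le (testJet b φ)))

theorem norm_testJet_dd {b : Periods} (φ : testSpace b) (i j : Fin 3) :
    ‖((φ.2.pderiv j).pderiv i).memLp.toLp (pderiv i (pderiv j φ.1))‖ ≤ ‖testJet b φ‖ :=
  (norm_le_pi_norm ((testJet b φ).2.2 i) j).trans ((norm_le_pi_norm (testJet b φ).2.2 i).trans
    ((norm_snd_le (testJet b φ).2).trans (norm_snd_le (testJet b φ))))

theorem lintegral_jetAbs_le {b : Periods} (φ : testSpace b) (x : Point) {r : ℝ} (h0 : 0 < r)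
    (h1 : r ≤ 1) :
    ∫⁻ w in cell b, ENNReal.ofReal (jetAbs φ.1 (x + r • w)) ≤
      13 * ENNReal.ofReal (r ^ (-(3 / 2) : ℝ) *
        (√(volume.real (cell b)) * ‖testJet b φ‖)) := by
  set B := ENNReal.ofReal (r ^ (-(3 / 2) : ℝ) * (√(volume.real (cell b)) * ‖testJet b φ‖)) with hB
  have hr : 0 ≤ r ^ (-(3 / 2) : ℝ) := by positivity
  have hs : 0 ≤ √(volume.real (cell b)) := Real.sqrt_nonneg _
  have c0 := φ.2.continuous
  have c1 := fun i => (φ.2.pderiv i).continuous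
  have c2 := fun i j => ((φ.2.pderiv j).pderiv i).continuous
  have b0 : ∫⁻ w in cell b, ENNReal.ofReal |φ.1 (x + r • w)| ≤ B :=
    (φ.2.lintegral_abs_add_smul_le x h0 h1).trans (ENNReal.ofReal_le_ofReal (by
      gcongr; exact norm_testJet_val φ))
  have b1 : ∀ i, ∫⁻ w in cell b, ENNReal.ofReal |pderiv i φ.1 (x + r • w)| ≤ B := fun i =>
    ((φ.2.pderiv i).lintegral_abs_add_smul_le x h0 h1).trans (ENNReal.ofReal_le_ofReal (by
      gcongr; exact norm_testJet_d φ i))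
  have b2 : ∀ i j, ∫⁻ w in cell b, ENNReal.ofReal |pderiv i (pderiv j φ.1) (x + r • w)| ≤ B :=
    fun i j => (((φ.2.pderiv j).pderiv i).lintegral_abs_add_smul_le x h0 h1).trans
      (ENNReal.ofReal_le_ofReal (by gcongr; exact norm_testJet_dd φ i j))
  have hsplit : ∀ w : Point, ENNReal.ofReal (jetAbs φ.1 (x + r • w)) =
      ENNReal.ofReal |φ.1 (x + r • w)| + ∑ i, ENNReal.ofReal |pderiv i φ.1 (x + r • w)| +
        ∑ i, ∑ j, ENNReal.ofReal |pderiv i (pderiv j φ.1) (x + r • w)| := by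
    intro w
    unfold jetAbs
    rw [ENNReal.ofReal_add (by positivity) (by positivity),
      ENNReal.ofReal_add (by positivity) (by positivity),
      ENNReal.ofReal_sum_of_nonneg fun i _ => abs_nonneg _,
      ENNReal.ofReal_sum_of_nonneg fun i _ => Finset.sum_nonneg fun j _ => abs_nonneg _]
    congr 1
    exact Finset.sum_congr rfl fun i _ => ENNReal.ofReal_sum_of_nonneg fun j _ => abs_nonneg _
  simp only [hsplit]
  have m0 : Measurable fun w : Point => ENNReal.ofReal |φ.1 (x + r • w)| :=
    (Continuous.measurable (by fun_prop)).ennreal_ofReal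
  have m1 : ∀ i, Measurable fun w : Point => ENNReal.ofReal |pderiv i φ.1 (x + r • w)| :=
    fun i => (Continuous.measurable (by fun_prop)).ennreal_ofReal
  have m2 : ∀ i j, Measurable fun w : Point =>
      ENNReal.ofReal |pderiv i (pderiv j φ.1) (x + r • w)| :=
    fun i j => (Continuous.measurable (by fun_prop)).ennreal_ofReal
  have m01 : Measurable fun w : Point => ENNReal.ofReal |φ.1 (x + r • w)| +
      ∑ i, ENNReal.ofReal |pderiv i φ.1 (x + r • w)| :=
    m0.add (Finset.measurable_fun_sum _ fun i _ => m1 i)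
  rw [lintegral_add_left m01,
    lintegral_add_left m0, lintegral_finsetSum _ fun i _ => m1 i,
    lintegral_finsetSum _ fun i _ => Finset.measurable_fun_sum _ fun j _ => m2 i j]
  have e2 : ∀ i, ∫⁻ w in cell b, ∑ j, ENNReal.ofReal |pderiv i (pderiv j φ.1) (x + r • w)| ≤
      3 * B := fun i => by
    rw [lintegral_finsetSum _ fun j _ => m2 i j]
    refine (Finset.sum_le_sum fun j _ => b2 i j).trans (by simp)
  calc _ ≤ B + ∑ _i : Fin 3, B + ∑ _i : Fin 3, 3 * B :=
        add_le_add (add_le_add b0 (Finset.sum_le_sum fun i _ => b1 i))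
          (Finset.sum_le_sum fun i _ => e2 i)
    _ = 13 * B := by
        simp only [Finset.sum_const, Finset.card_univ, Fintype.card_fin, nsmul_eq_mul]
        ring

/-- The embedding of `H²` in the bounded functions, for test functions. -/
theorem exists_sup_bound (b : Periods) :
    ∃ C, 0 ≤ C ∧ ∀ (φ : testSpace b) (x : Point), |φ.1 x| ≤ C * ‖testJet b φ‖ := by
  obtain ⟨M₀, hM₀⟩ := (cell_bounded b).exists_norm_le
  set M := max M₀ 1 with hM
  have hM1 : 1 ≤ M := le_max_right _ _
  have hw : ∀ w ∈ cell b, ∀ i, |w i| ≤ M := fun w hw i =>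
    (norm_le_pi_norm w i).trans ((hM₀ w hw).trans (le_max_left _ _))
  set v := volume.real (cell b) with hv
  have hv0 : 0 < v := by
    rw [hv, measureReal_def]
    exact ENNReal.toReal_pos (cell_volume_pos b).ne' (cell_volume_lt_top b).ne
  have hint : IntervalIntegrable (fun r : ℝ => r * r ^ (-(3 / 2) : ℝ)) volume 0 1 := by
    refine (intervalIntegral.intervalIntegrable_rpow' (r := -(1 / 2)) (by norm_num)).congr ?_
    intro r hr
    have hr0 : 0 < r := by simpa using hr.1
    change r ^ (-(1 / 2) : ℝ) = r * r ^ (-(3 / 2) : ℝ)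
    nth_rewrite 2 [← Real.rpow_one r]
    rw [← Real.rpow_add hr0]
    norm_num
  have hK : ∫⁻ r in Set.Ioc (0 : ℝ) 1, ENNReal.ofReal (r * r ^ (-(3 / 2) : ℝ)) < ⊤ :=
    ((intervalIntegrable_iff_integrableOn_Ioc_of_le zero_le_one).1 hint).lintegral_lt_top
  set K := ∫⁻ r in Set.Ioc (0 : ℝ) 1, ENNReal.ofReal (r * r ^ (-(3 / 2) : ℝ)) with hKdef
  refine ⟨4 * M ^ 2 * 13 * (√v * K.toReal) / v, by positivity, fun φ x => ?_⟩
  set N := ‖testJet b φ‖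
  have hj := φ.2.continuous_jetAbs
  have h1 : ∀ w ∈ cell b, ENNReal.ofReal |φ.1 x| ≤ ∫⁻ r in Set.Ioc (0 : ℝ) 1,
      ENNReal.ofReal (r * (4 * M ^ 2 * jetAbs φ.1 (x + r • w))) := by
    intro w hwc
    have hi : IntervalIntegrable (fun r : ℝ => r * (4 * M ^ 2 * jetAbs φ.1 (x + r • w)))
        volume 0 1 := Continuous.intervalIntegrable (by fun_prop) _ _
    refine (ENNReal.ofReal_le_ofReal (φ.2.abs_le_integral_ray hM1 x w (hw w hwc))).trans ?_
    rw [intervalIntegral.integral_of_le zero_le_one, ofReal_integral_eq_lintegral_ofReal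
      ((intervalIntegrable_iff_integrableOn_Ioc_of_le zero_le_one).1 hi)]
    filter_upwards [ae_restrict_mem measurableSet_Ioc] with r hr
    exact mul_nonneg hr.1.le (mul_nonneg (by positivity) (jetAbs_nonneg _ _))
  have h2 : ENNReal.ofReal |φ.1 x| * volume (cell b) ≤
      ENNReal.ofReal (4 * M ^ 2) * (13 * ENNReal.ofReal (√v * N)) * K := by
    calc ENNReal.ofReal |φ.1 x| * volume (cell b)
        = ∫⁻ _ in cell b, ENNReal.ofReal |φ.1 x| := by rw [setLIntegral_const]
      _ ≤ ∫⁻ w in cell b, ∫⁻ r in Set.Ioc (0 : ℝ) 1,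
            ENNReal.ofReal (r * (4 * M ^ 2 * jetAbs φ.1 (x + r • w))) :=
          setLIntegral_mono' (cell_measurableSet b) h1
      _ = ∫⁻ r in Set.Ioc (0 : ℝ) 1, ∫⁻ w in cell b,
            ENNReal.ofReal (r * (4 * M ^ 2 * jetAbs φ.1 (x + r • w))) := by
          refine lintegral_lintegral_swap ?_
          have hm : Measurable fun p : Point × ℝ =>
              ENNReal.ofReal (p.2 * (4 * M ^ 2 * jetAbs φ.1 (x + p.2 • p.1))) :=
            (Continuous.measurable (by fun_prop)).ennreal_ofReal
          exact hm.aemeasurable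
      _ ≤ ∫⁻ r in Set.Ioc (0 : ℝ) 1, ENNReal.ofReal (4 * M ^ 2) *
            (13 * ENNReal.ofReal (√v * N)) * ENNReal.ofReal (r * r ^ (-(3 / 2) : ℝ)) := by
          refine setLIntegral_mono' measurableSet_Ioc fun r hr => ?_
          have e : ∀ w : Point, ENNReal.ofReal (r * (4 * M ^ 2 * jetAbs φ.1 (x + r • w))) =
              ENNReal.ofReal (r * (4 * M ^ 2)) * ENNReal.ofReal (jetAbs φ.1 (x + r • w)) :=
            fun w => by
              rw [← ENNReal.ofReal_mul (mul_nonneg hr.1.le (by positivity)), ← mul_assoc]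
          simp only [e]
          rw [lintegral_const_mul _
            (Measurable.ennreal_ofReal (Continuous.measurable (by fun_prop)))]
          refine (mul_le_mul_right (lintegral_jetAbs_le φ x hr.1 hr.2) _).trans (le_of_eq ?_)
          rw [ENNReal.ofReal_mul hr.1.le, ENNReal.ofReal_mul (Real.rpow_nonneg hr.1.le _),
            ENNReal.ofReal_mul hr.1.le]
          ring
      _ = _ := by
          rw [lintegral_const_mul']
          exact ENNReal.mul_ne_top ENNReal.ofReal_ne_top
            (ENNReal.mul_ne_top (by norm_num) ENNReal.ofReal_ne_top)
  have h3 := ENNReal.toReal_mono (by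
    refine ENNReal.mul_ne_top (ENNReal.mul_ne_top ENNReal.ofReal_ne_top
      (ENNReal.mul_ne_top (by norm_num) ENNReal.ofReal_ne_top)) hK.ne) h2
  have hN : 0 ≤ √v * N := mul_nonneg (Real.sqrt_nonneg _) (norm_nonneg _)
  simp only [ENNReal.toReal_mul, ENNReal.toReal_ofReal (abs_nonneg (φ.1 x)),
    ENNReal.toReal_ofReal hN, ENNReal.toReal_ofReal (by positivity : 0 ≤ 4 * M ^ 2)] at h3
  rw [div_mul_eq_mul_div, le_div_iff₀ hv0]
  refine h3.trans (le_of_eq ?_)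
  simp
  ring

/-! ### Integral identities and the sharp Poincaré inequality -/

theorem IsTest.pderiv_comm {b : Periods} {φ : Point → ℝ} (h : IsTest b φ) (i j : Fin 3) :
    Convection.pderiv i (Convection.pderiv j φ) = Convection.pderiv j (Convection.pderiv i φ) := by
  have hd : Differentiable ℝ (fderiv ℝ φ) :=
    (h.smooth.fderiv_right (m := 1) (by norm_cast)).differentiable (by simp)
  have key : ∀ (i j : Fin 3) (x : Point), Convection.pderiv i (Convection.pderiv j φ) x =
      fderiv ℝ (fderiv ℝ φ) x (Pi.single i 1) (Pi.single j 1) := by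
    intro i j x
    change fderiv ℝ (fun y => fderiv ℝ φ y (Pi.single j 1)) x (Pi.single i 1) = _
    rw [fderiv_clm_apply (hd x) (differentiableAt_const _)]
    simp
  ext x
  rw [key, key]
  exact (h.smooth.contDiffAt.isSymmSndFDerivAt (by
    rw [minSmoothness_of_isRCLikeNormedField]; norm_cast)).eq _ _

/-- Multiplication by a function of `z` that is smooth inside the layer preserves test functions. -/
theorem IsTest.mul_vertical {b : Periods} {φ : Point → ℝ} (h : IsTest b φ) {g : ℝ → ℝ}
    (hg : ∀ z ∈ Set.Ioo (0 : ℝ) 1, ContDiffAt ℝ ∞ g z) : IsTest b (fun x => g (x 2) * φ x) where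
  smooth := by
    obtain ⟨lo, hi, h0, h1, hz⟩ := h.support
    refine contDiff_iff_contDiffAt.2 fun x => ?_
    by_cases hx : x 2 ∈ Set.Icc lo hi
    · refine ContDiffAt.mul ?_ h.smooth.contDiffAt
      exact (hg (x 2) ⟨h0.trans_le hx.1, hx.2.trans_lt h1⟩).comp x
        (contDiff_apply ℝ ℝ (2 : Fin 3)).contDiffAt
    · have hopen : IsOpen {y : Point | y 2 ∉ Set.Icc lo hi} :=
        (isClosed_Icc.preimage (continuous_apply (2 : Fin 3))).isOpen_compl
      refine (contDiffAt_const (c := (0 : ℝ))).congr_of_eventuallyEq ?_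
      filter_upwards [hopen.mem_nhds hx] with y hy
      rw [hz y hy, mul_zero]
  periodic i x := by
    rw [h.periodic]
    simp [horiz]
  support := by
    obtain ⟨lo, hi, h0, h1, hz⟩ := h.support
    exact ⟨lo, hi, h0, h1, fun x hx => by rw [hz x hx, mul_zero]⟩

theorem pderiv_vertical {g : ℝ → ℝ} {g' : ℝ} {x : Point} (hg : HasDerivAt g g' (x 2)) :
    pderiv 2 (fun y => g (y 2)) x = g' := by
  have h2 : HasFDerivAt (fun y : Point => y 2)
      (ContinuousLinearMap.proj (R := ℝ) (φ := fun _ : Fin 3 => ℝ) 2) x :=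
    (ContinuousLinearMap.proj (R := ℝ) (φ := fun _ : Fin 3 => ℝ) 2).hasFDerivAt
  have h1 := hg.comp_hasFDerivAt x h2
  change fderiv ℝ (g ∘ fun y : Point => y 2) x (Pi.single 2 1) = g'
  rw [h1.fderiv]
  simp

/-- The Poincaré inequality with the sharp constant: with `g = cot (πz)`, the function
`(∂φ/∂z)² - π²φ²` is the sum of the square `(∂φ/∂z - πgφ)²` and the derivative `π ∂(gφ²)/∂z`. -/
theorem IsTest.poincare {b : Periods} {φ : Point → ℝ} (h : IsTest b φ) :
    Real.pi ^ 2 * ∫ x in cell b, φ x ^ 2 ≤ ∫ x in cell b, Convection.pderiv 2 φ x ^ 2 := by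
  set g : ℝ → ℝ := fun z => Real.cos (Real.pi * z) / Real.sin (Real.pi * z) with hgdef
  have hs : ∀ z ∈ Set.Ioo (0 : ℝ) 1, Real.sin (Real.pi * z) ≠ 0 := fun z hz =>
    (Real.sin_pos_of_pos_of_lt_pi (mul_pos Real.pi_pos hz.1)
      (mul_lt_of_lt_one_right Real.pi_pos hz.2)).ne'
  have hg : ∀ z ∈ Set.Ioo (0 : ℝ) 1, ContDiffAt ℝ ∞ g z := fun z hz =>
    ContDiffAt.div (by fun_prop) (by fun_prop) (hs z hz)
  have hg' : ∀ z ∈ Set.Ioo (0 : ℝ) 1, HasDerivAt g (-(Real.pi * (1 + g z ^ 2))) z := by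
    intro z hz
    have e0 : HasDerivAt (fun z : ℝ => Real.pi * z) Real.pi z := by
      simpa using (hasDerivAt_id z).const_mul Real.pi
    refine (e0.cos.div e0.sin (hs z hz)).congr_deriv ?_
    have := hs z hz
    simp only [hgdef]
    field_simp
    ring
  have hsq : IsTest b (fun x => φ x * φ x) := h.mul h
  have hψ := hsq.mul_vertical hg
  have h0 := hψ.integral_pderiv 2
  have hi1 : IntegrableOn (fun x => φ x ^ 2) (cell b) := h.memLp.integrable_sq
  have hi2 : IntegrableOn (fun x => Convection.pderiv 2 φ x ^ 2) (cell b) :=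
    (h.pderiv 2).memLp.integrable_sq
  have hi3 := (hψ.pderiv 2).integrableOn_cell
  have hle : ∫ x in cell b, (Real.pi ^ 2 * φ x ^ 2 +
      Real.pi * Convection.pderiv 2 (fun x => g (x 2) * (φ x * φ x)) x) ≤
        ∫ x in cell b, Convection.pderiv 2 φ x ^ 2 := by
    refine setIntegral_mono_on ((hi1.const_mul _).add (hi3.const_mul _)) hi2
      (cell_measurableSet b) fun x hx => ?_
    have hz : x 2 ∈ Set.Ioo (0 : ℝ) 1 := hx.2
    have hdg : DifferentiableAt ℝ (fun y : Point => g (y 2)) x :=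
      DifferentiableAt.comp (g := g) (f := fun y : Point => y 2) x
        (hg' _ hz).differentiableAt (differentiableAt_apply (2 : Fin 3) x)
    rw [pderiv_mul hdg (hsq.differentiable x), pderiv_vertical (hg' _ hz),
      pderiv_mul (h.differentiable x) (h.differentiable x)]
    nlinarith [sq_nonneg (Convection.pderiv 2 φ x - Real.pi * g (x 2) * φ x)]
  rw [integral_add (hi1.const_mul _) (hi3.const_mul _), integral_const_mul, integral_const_mul,
    h0] at hle
  linarith

/-! ### Extension to the closure of the test functions -/

theorem testJet_mem (b : Periods) (φ : testSpace b) : testJet b φ ∈ H20 b :=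
  subset_closure ⟨φ, rfl⟩

/-- A closed condition that holds for the jets of test functions holds in `H20`. -/
theorem H20_induction {b : Periods} {p : Jet b → Prop} (hp : IsClosed {J | p J})
    (h : ∀ φ, p (testJet b φ)) {J : Jet b} (hJ : J ∈ H20 b) : p J :=
  closure_minimal (t := {J | p J}) (by rintro _ ⟨φ, rfl⟩; exact h φ) hp hJ

theorem continuous_val (b : Periods) : Continuous (Jet.val : Jet b → L2 b) := continuous_fst

theorem continuous_d (b : Periods) (i : Fin 3) : Continuous fun J : Jet b => J.d i :=
  (continuous_apply i).comp (continuous_fst.comp continuous_snd)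

theorem continuous_dd (b : Periods) (i j : Fin 3) : Continuous fun J : Jet b => J.2.2 i j :=
  (continuous_apply j).comp ((continuous_apply i).comp (continuous_snd.comp continuous_snd))

theorem continuous_lap (b : Periods) : Continuous (Jet.lap : Jet b → L2 b) :=
  continuous_finsetSum _ fun i _ => continuous_dd b i i

theorem poincare_val {b : Periods} {J : Jet b} (hJ : J ∈ H20 b) :
    Real.pi ^ 2 * ‖J.val‖ ^ 2 ≤ ‖J.d 2‖ ^ 2 := by
  refine H20_induction (p := fun J => Real.pi ^ 2 * ‖J.val‖ ^ 2 ≤ ‖J.d 2‖ ^ 2) ?_ ?_ hJ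
  · exact isClosed_le (((continuous_val b).norm.pow 2).const_mul _) ((continuous_d b 2).norm.pow 2)
  · intro φ
    change Real.pi ^ 2 * ‖φ.2.memLp.toLp φ.1‖ ^ 2 ≤
      ‖(φ.2.pderiv 2).memLp.toLp (pderiv 2 φ.1)‖ ^ 2
    rw [norm_toLp_sq, norm_toLp_sq]
    exact φ.2.poincare

/-- Integration by parts: `‖∇φ‖² = -(Δφ, φ)`. -/
theorem sum_norm_d_sq {b : Periods} {J : Jet b} (hJ : J ∈ H20 b) :
    ∑ j, ‖J.d j‖ ^ 2 = -inner ℝ J.lap J.val := by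
  refine H20_induction (p := fun J => ∑ j, ‖J.d j‖ ^ 2 = -inner ℝ J.lap J.val) ?_ ?_ hJ
  · exact isClosed_eq (continuous_finsetSum _ fun j _ => (continuous_d b j).norm.pow 2)
      ((continuous_lap b).inner (continuous_val b)).neg
  · intro φ
    change ∑ j, ‖(φ.2.pderiv j).memLp.toLp (pderiv j φ.1)‖ ^ 2 =
      -inner ℝ (∑ j, ((φ.2.pderiv j).pderiv j).memLp.toLp (pderiv j (pderiv j φ.1)))
        (φ.2.memLp.toLp φ.1)
    rw [sum_inner, ← Finset.sum_neg_distrib]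
    refine Finset.sum_congr rfl fun j _ => ?_
    rw [norm_toLp_sq, inner_toLp, ← (φ.2.pderiv j).integral_mul_pderiv φ.2 j]
    simp only [sq]

/-- Integrating by parts twice, `‖∇²φ‖ = ‖Δφ‖`. -/
theorem sum_norm_dd_sq {b : Periods} {J : Jet b} (hJ : J ∈ H20 b) :
    ∑ i, ∑ j, ‖J.2.2 i j‖ ^ 2 = ‖J.lap‖ ^ 2 := by
  refine H20_induction (p := fun J => ∑ i, ∑ j, ‖J.2.2 i j‖ ^ 2 = ‖J.lap‖ ^ 2) ?_ ?_ hJ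
  · exact isClosed_eq (continuous_finsetSum _ fun i _ => continuous_finsetSum _ fun j _ =>
      (continuous_dd b i j).norm.pow 2) ((continuous_lap b).norm.pow 2)
  · intro φ
    change ∑ i, ∑ j, ‖((φ.2.pderiv j).pderiv i).memLp.toLp (pderiv i (pderiv j φ.1))‖ ^ 2 =
      ‖∑ j, ((φ.2.pderiv j).pderiv j).memLp.toLp (pderiv j (pderiv j φ.1))‖ ^ 2
    rw [← real_inner_self_eq_norm_sq, sum_inner]
    refine Finset.sum_congr rfl fun i _ => ?_
    rw [inner_sum]
    refine Finset.sum_congr rfl fun j _ => ?_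
    rw [norm_toLp_sq, inner_toLp]
    have hj := φ.2.pderiv j
    have hii := (φ.2.pderiv i).pderiv i
    have h1 := (hj.pderiv i).integral_mul_pderiv hj i
    have h2 := hii.integral_mul_pderiv hj j
    have h3 : pderiv i (pderiv i (pderiv j φ.1)) = pderiv j (pderiv i (pderiv i φ.1)) := by
      rw [φ.2.pderiv_comm i j, (φ.2.pderiv i).pderiv_comm i j]
    rw [h3] at h1
    simp only [sq]
    rw [h1, h2]

theorem sum_norm_d_sq_ge {b : Periods} {J : Jet b} (hJ : J ∈ H20 b) :
    Real.pi ^ 2 * ‖J.val‖ ^ 2 ≤ ∑ j, ‖J.d j‖ ^ 2 :=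
  (poincare_val hJ).trans
    (Finset.single_le_sum (f := fun j => ‖J.d j‖ ^ 2) (fun _ _ => sq_nonneg _)
      (Finset.mem_univ 2))

/-- `‖Δφ‖ ≥ π² ‖φ‖`, since `π² ‖φ‖² ≤ ‖∇φ‖² = -(Δφ, φ) ≤ ‖Δφ‖ ‖φ‖`. -/
theorem norm_lap_sq_ge {b : Periods} {J : Jet b} (hJ : J ∈ H20 b) :
    Real.pi ^ 4 * ‖J.val‖ ^ 2 ≤ ‖J.lap‖ ^ 2 := by
  have h1 := sum_norm_d_sq_ge hJ
  rw [sum_norm_d_sq hJ] at h1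
  have h2 := (neg_le_abs (inner ℝ J.lap J.val)).trans (abs_real_inner_le_norm J.lap J.val)
  have h3 : Real.pi ^ 2 * ‖J.val‖ ≤ ‖J.lap‖ := by
    rcases (norm_nonneg J.val).eq_or_lt with h0 | h0
    · rw [← h0]; simp
    · refine le_of_mul_le_mul_right ?_ h0
      nlinarith
  calc Real.pi ^ 4 * ‖J.val‖ ^ 2 = (Real.pi ^ 2 * ‖J.val‖) ^ 2 := by ring
    _ ≤ ‖J.lap‖ ^ 2 := by gcongr

/-- The gradient and the Laplacian control the norm of `H²`. -/
theorem norm_sq_le {b : Periods} {J : Jet b} (hJ : J ∈ H20 b) :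
    ‖J‖ ^ 2 ≤ ∑ j, ‖J.d j‖ ^ 2 + ‖J.lap‖ ^ 2 := by
  set s := ∑ j, ‖J.d j‖ ^ 2 + ‖J.lap‖ ^ 2 with hs
  have hd0 : 0 ≤ ∑ j, ‖J.d j‖ ^ 2 := by positivity
  have hs0 : 0 ≤ s := by positivity
  have hv : ‖J.1‖ ≤ √s := by
    refine Real.le_sqrt_of_sq_le ?_
    have h1 := sum_norm_d_sq_ge hJ
    have h2 : (1 : ℝ) ≤ Real.pi ^ 2 := by nlinarith [Real.pi_gt_three]
    have h3 : ‖J.1‖ ^ 2 ≤ Real.pi ^ 2 * ‖J.1‖ ^ 2 := le_mul_of_one_le_left (sq_nonneg _) h2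
    exact h3.trans (h1.trans (le_add_of_nonneg_right (sq_nonneg _)))
  have hd : ∀ j, ‖J.2.1 j‖ ≤ √s := fun j => by
    refine Real.le_sqrt_of_sq_le ?_
    have h1 := Finset.single_le_sum (f := fun j => ‖J.d j‖ ^ 2) (fun _ _ => sq_nonneg _)
      (Finset.mem_univ j)
    exact h1.trans (le_add_of_nonneg_right (sq_nonneg _))
  have hdd : ∀ i j, ‖J.2.2 i j‖ ≤ √s := fun i j => by
    refine Real.le_sqrt_of_sq_le ?_
    have h1 := Finset.single_le_sum (f := fun j => ‖J.2.2 i j‖ ^ 2) (fun _ _ => sq_nonneg _)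
      (Finset.mem_univ j)
    have h2 := Finset.single_le_sum (f := fun i => ∑ j, ‖J.2.2 i j‖ ^ 2)
      (fun _ _ => Finset.sum_nonneg fun _ _ => sq_nonneg _) (Finset.mem_univ i)
    have h3 := sum_norm_dd_sq hJ
    linarith
  have hJs : ‖J‖ ≤ √s := by
    refine norm_prod_le_iff.2 ⟨hv, norm_prod_le_iff.2 ⟨?_, ?_⟩⟩
    · exact (pi_norm_le_iff_of_nonneg (Real.sqrt_nonneg _)).2 hd
    · exact (pi_norm_le_iff_of_nonneg (Real.sqrt_nonneg _)).2 fun i =>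
        (pi_norm_le_iff_of_nonneg (Real.sqrt_nonneg _)).2 fun j => hdd i j
  calc ‖J‖ ^ 2 ≤ √s ^ 2 := by gcongr
    _ = s := Real.sq_sqrt hs0

/-! ### Linearity of the jet -/

theorem IsTest.pderiv_add {b : Periods} {φ ψ : Point → ℝ} (h : IsTest b φ) (h' : IsTest b ψ)
    (i : Fin 3) : Convection.pderiv i (φ + ψ) = Convection.pderiv i φ + Convection.pderiv i ψ := by
  ext x
  simp only [Convection.pderiv, Pi.add_apply]
  rw [fderiv_add (h.differentiable x) (h'.differentiable x)]
  rfl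

theorem IsTest.pderiv_smul {b : Periods} {φ : Point → ℝ} (h : IsTest b φ) (c : ℝ)
    (i : Fin 3) : Convection.pderiv i (c • φ) = c • Convection.pderiv i φ := by
  ext x
  simp only [Convection.pderiv, Pi.smul_apply]
  rw [fderiv_const_smul (h.differentiable x)]
  rfl

/-- `testJet` as a linear map. -/
noncomputable def testJetHom (b : Periods) : testSpace b →ₗ[ℝ] Jet b where
  toFun := testJet b
  map_add' φ ψ := by
    have e1 : ∀ i, pderiv i (φ + ψ).1 = pderiv i φ.1 + pderiv i ψ.1 :=
      fun i => φ.2.pderiv_add ψ.2 i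
    have e2 : ∀ i j, pderiv i (pderiv j (φ + ψ).1) =
        pderiv i (pderiv j φ.1) + pderiv i (pderiv j ψ.1) := fun i j => by
      rw [e1, (φ.2.pderiv j).pderiv_add (ψ.2.pderiv j) i]
    refine Prod.ext ?_ (Prod.ext (funext fun i => ?_) (funext fun i => funext fun j => ?_))
    · exact MemLp.toLp_add φ.2.memLp ψ.2.memLp
    · refine (MemLp.toLp_congr ((φ + ψ).2.pderiv i).memLp
        ((φ.2.pderiv i).memLp.add (ψ.2.pderiv i).memLp)
        (Eventually.of_forall fun x => congrFun (e1 i) x)).trans ?_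
      exact MemLp.toLp_add (φ.2.pderiv i).memLp (ψ.2.pderiv i).memLp
    · refine (MemLp.toLp_congr (((φ + ψ).2.pderiv j).pderiv i).memLp
        (((φ.2.pderiv j).pderiv i).memLp.add ((ψ.2.pderiv j).pderiv i).memLp)
        (Eventually.of_forall fun x => congrFun (e2 i j) x)).trans ?_
      exact MemLp.toLp_add ((φ.2.pderiv j).pderiv i).memLp ((ψ.2.pderiv j).pderiv i).memLp
  map_smul' c φ := by
    have e1 : ∀ i, pderiv i (c • φ).1 = c • pderiv i φ.1 := fun i => φ.2.pderiv_smul c i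
    have e2 : ∀ i j, pderiv i (pderiv j (c • φ).1) = c • pderiv i (pderiv j φ.1) := fun i j => by
      rw [e1, (φ.2.pderiv j).pderiv_smul c i]
    refine Prod.ext ?_ (Prod.ext (funext fun i => ?_) (funext fun i => funext fun j => ?_))
    · exact MemLp.toLp_const_smul c φ.2.memLp
    · refine (MemLp.toLp_congr ((c • φ).2.pderiv i).memLp ((φ.2.pderiv i).memLp.const_smul c)
        (Eventually.of_forall fun x => congrFun (e1 i) x)).trans ?_
      exact MemLp.toLp_const_smul c (φ.2.pderiv i).memLp
    · refine (MemLp.toLp_congr (((c • φ).2.pderiv j).pderiv i).memLp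
        (((φ.2.pderiv j).pderiv i).memLp.const_smul c)
        (Eventually.of_forall fun x => congrFun (e2 i j) x)).trans ?_
      exact MemLp.toLp_const_smul c ((φ.2.pderiv j).pderiv i).memLp

/-- `H20` as a closed subspace. -/
noncomputable def H20Submodule (b : Periods) : Submodule ℝ (Jet b) :=
  (LinearMap.range (testJetHom b)).topologicalClosure

/-! ### Compactness of the embedding of `H²` in `L²` -/

/-- Bounded sequences in a separable Hilbert space have weakly convergent subsequences. -/
theorem exists_weak_subseq {X : Type*} [NormedAddCommGroup X] [InnerProductSpace ℝ X]
    [CompleteSpace X] [TopologicalSpace.SeparableSpace X] {x : ℕ → X} {C : ℝ}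
    (hx : ∀ n, ‖x n‖ ≤ C) :
    ∃ (a : X) (σ : ℕ → ℕ), StrictMono σ ∧
      ∀ y, Tendsto (fun n => inner ℝ (x (σ n)) y) atTop (𝓝 (inner ℝ a y)) := by
  have h := WeakDual.isSeqCompact_closedBall ℝ X 0 C
  obtain ⟨f, -, σ, hσ, hf⟩ := h (x := fun n => StrongDual.toWeakDual
    (InnerProductSpace.toDual ℝ X (x n))) (fun n => by
      change InnerProductSpace.toDual ℝ X (x n) ∈ Metric.closedBall 0 C
      simpa using hx n)
  refine ⟨(InnerProductSpace.toDual ℝ X).symm (WeakDual.toStrongDual f), σ, hσ, fun y => ?_⟩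
  have h2 := (WeakDual.eval_continuous y).continuousAt.tendsto.comp hf
  refine (h2.congr fun n => ?_).trans_eq ?_
  · rfl
  · simp

/-- The index set of the thirteen components of a jet. -/
abbrev JetIndex := Unit ⊕ Fin 3 ⊕ Fin 3 × Fin 3

/-- The family of the components of a jet, as an element of a Hilbert space. -/
noncomputable def jetToHilbert (b : Periods) :
    Jet b →L[ℝ] PiLp 2 (fun _ : JetIndex => L2 b) where
  toFun J := WithLp.toLp 2 (Sum.elim (fun _ => J.1) (Sum.elim J.2.1 fun p => J.2.2 p.1 p.2))
  map_add' J K := by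
    ext1 i
    rcases i with i | i | i <;> rfl
  map_smul' c J := by
    ext1 i
    rcases i with i | i | i <;> rfl
  cont := by
    refine (PiLp.continuous_toLp 2 _).comp (continuous_pi fun i => ?_)
    rcases i with i | i | i
    · exact continuous_val b
    · exact continuous_d b i
    · exact continuous_dd b i.1 i.2

instance separableSpace_piLp (b : Periods) :
    TopologicalSpace.SeparableSpace (PiLp 2 (fun _ : JetIndex => L2 b)) := by
  have h1 : Fact ((2 : ENNReal) ≠ ⊤) := ⟨by norm_num⟩
  have h2 : SecondCountableTopology (L2 b) := Lp.SecondCountableTopology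
  exact (WithLp.toLp_surjective 2).denseRange.separableSpace
    (PiLp.continuous_toLp 2 fun _ : JetIndex => L2 b)

theorem norm_le_jetToHilbert {b : Periods} (J : Jet b) : ‖J‖ ≤ ‖jetToHilbert b J‖ := by
  have h := fun i => PiLp.norm_apply_le (jetToHilbert b J) i
  refine norm_prod_le_iff.2 ⟨h (Sum.inl ()), norm_prod_le_iff.2 ⟨?_, ?_⟩⟩
  · exact (pi_norm_le_iff_of_nonneg (norm_nonneg _)).2 fun i => h (Sum.inr (Sum.inl i))
  · exact (pi_norm_le_iff_of_nonneg (norm_nonneg _)).2 fun i =>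
      (pi_norm_le_iff_of_nonneg (norm_nonneg _)).2 fun j => h (Sum.inr (Sum.inr (i, j)))

/-- Evaluation at a point is a bounded functional of the jet of a test function. -/
theorem exists_eval_functional (b : Periods) (x : Point) :
    ∃ y : PiLp 2 (fun _ : JetIndex => L2 b), ∀ φ : testSpace b,
      inner ℝ (jetToHilbert b (testJet b φ)) y = φ.1 x := by
  obtain ⟨C, hC0, hC⟩ := exists_sup_bound b
  let T : testSpace b →ₗ[ℝ] PiLp 2 (fun _ : JetIndex => L2 b) :=
    (jetToHilbert b).toLinearMap ∘ₗ testJetHom b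
  have hT : ∀ φ y, |φ.1 y| ≤ C * ‖T φ‖ := fun φ y =>
    (hC φ y).trans (mul_le_mul_of_nonneg_left (norm_le_jetToHilbert _) hC0)
  have hinj : Function.Injective T := by
    refine (injective_iff_map_eq_zero T).2 fun φ hφ => Subtype.ext (funext fun y => ?_)
    have h1 := hT φ y
    rw [hφ, norm_zero, mul_zero] at h1
    exact abs_nonpos_iff.1 h1
  let e := LinearEquiv.ofInjective T hinj
  let ev : testSpace b →ₗ[ℝ] ℝ := (LinearMap.proj x).comp (testSpace b).subtype
  let f : StrongDual ℝ (LinearMap.range T) := (ev ∘ₗ e.symm.toLinearMap).mkContinuous C (by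
    intro v
    obtain ⟨φ, rfl⟩ := e.surjective v
    have h1 : (ev ∘ₗ e.symm.toLinearMap) (e φ) = φ.1 x := by
      simp only [LinearMap.comp_apply, LinearEquiv.coe_coe, LinearEquiv.symm_apply_apply]
      rfl
    rw [h1]
    exact hT φ x)
  obtain ⟨g, hg, -⟩ := exists_extension_norm_eq (LinearMap.range T) f
  refine ⟨(InnerProductSpace.toDual ℝ _).symm g, fun φ => ?_⟩
  rw [real_inner_comm, InnerProductSpace.toDual_symm_apply]
  have h1 := hg (e φ)
  have h2 : f (e φ) = φ.1 x := by
    change (ev ∘ₗ e.symm.toLinearMap) (e φ) = φ.1 x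
    simp only [LinearMap.comp_apply, LinearEquiv.coe_coe, LinearEquiv.symm_apply_apply]
    rfl
  rw [h2] at h1
  exact h1

/-- Test functions bounded in `H²` have a subsequence that converges in `L²`: a weakly convergent
subsequence converges at every point, and the uniform bound is a dominating constant. -/
theorem exists_subseq_testJet {b : Periods} {φ : ℕ → testSpace b} {C : ℝ}
    (hφ : ∀ n, ‖testJet b (φ n)‖ ≤ C) :
    ∃ (g : L2 b) (σ : ℕ → ℕ), StrictMono σ ∧
      Tendsto (fun n => (testJet b (φ (σ n))).val) atTop (𝓝 g) := by
  obtain ⟨K, hK0, hK⟩ := exists_sup_bound b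
  have hbd : ∀ n, ‖jetToHilbert b (testJet b (φ n))‖ ≤ ‖jetToHilbert b‖ * C := fun n =>
    ((jetToHilbert b).le_opNorm _).trans (mul_le_mul_of_nonneg_left (hφ n) (norm_nonneg _))
  obtain ⟨a, σ, hσ, hw⟩ := exists_weak_subseq hbd
  choose y hy using exists_eval_functional b
  set F : Point → ℝ := fun x => inner ℝ a (y x) with hF
  have hpt : ∀ x, Tendsto (fun n => (φ (σ n)).1 x) atTop (𝓝 (F x)) := fun x => by
    simpa only [hy] using hw (y x)
  have hb : ∀ n x, |(φ n).1 x| ≤ K * C := fun n x =>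
    (hK _ x).trans (mul_le_mul_of_nonneg_left (hφ n) hK0)
  have hbF : ∀ x, |F x| ≤ K * C := fun x =>
    le_of_tendsto (hpt x).abs (Eventually.of_forall fun n => hb _ x)
  have hFm : Measurable F := measurable_of_tendsto_metrizable
    (fun n => (φ (σ n)).2.continuous.measurable) (tendsto_pi_nhds.2 hpt)
  have hFL : MemLp F 2 (cellMeasure b) :=
    MemLp.of_bound hFm.aestronglyMeasurable (K * C) (Eventually.of_forall hbF)
  refine ⟨hFL.toLp F, σ, hσ, ?_⟩
  rw [tendsto_iff_norm_sub_tendsto_zero]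
  have hsq : Tendsto (fun n => ‖(testJet b (φ (σ n))).val - hFL.toLp F‖ ^ 2) atTop (𝓝 0) := by
    have e : ∀ n, ‖(testJet b (φ (σ n))).val - hFL.toLp F‖ ^ 2 =
        ∫ x in cell b, ((φ (σ n)).1 x - F x) ^ 2 := fun n => by
      change ‖(φ (σ n)).2.memLp.toLp _ - hFL.toLp F‖ ^ 2 = _
      rw [← MemLp.toLp_sub, norm_toLp_sq]
      rfl
    simp only [e]
    have h0 : (0 : ℝ) = ∫ _ in cell b, (0 : ℝ) := by simp
    rw [h0]
    refine tendsto_integral_of_dominated_convergence (fun _ => (2 * (K * C)) ^ 2)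
      (fun n => ?_) (integrable_const _) (fun n => Eventually.of_forall fun x => ?_)
      (Eventually.of_forall fun x => ?_)
    · exact (((φ (σ n)).2.continuous.measurable.sub hFm).pow_const 2).aestronglyMeasurable
    · rw [Real.norm_eq_abs, abs_of_nonneg (sq_nonneg _), ← sq_abs]
      have h1 := (abs_sub ((φ (σ n)).1 x) (F x)).trans (add_le_add (hb _ x) (hbF x))
      exact pow_le_pow_left₀ (abs_nonneg _) (by linarith) 2
    · simpa using ((hpt x).sub_const (F x)).pow 2
  have h2 := hsq.sqrt
  simpa [Real.sqrt_sq (norm_nonneg _)] using h2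

/-- The embedding of `H20` in `L²` is compact. -/
theorem exists_subseq_val {b : Periods} {J : ℕ → Jet b} {C : ℝ} (hJ : ∀ n, J n ∈ H20 b)
    (hC : ∀ n, ‖J n‖ ≤ C) :
    ∃ (g : L2 b) (σ : ℕ → ℕ), StrictMono σ ∧ Tendsto (fun n => (J (σ n)).val) atTop (𝓝 g) := by
  have h1 : ∀ n : ℕ, ∃ φ : testSpace b, dist (J n) (testJet b φ) < 1 / ((n : ℝ) + 1) := fun n => by
    obtain ⟨_, ⟨φ, rfl⟩, hφ⟩ := Metric.mem_closure_iff.1 (hJ n) _ (Nat.one_div_pos_of_nat (n := n))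
    exact ⟨φ, hφ⟩
  choose φ hφ using h1
  have hd1 : ∀ n : ℕ, 1 / ((n : ℝ) + 1) ≤ 1 := fun n => by
    rw [div_le_one (by positivity)]
    linarith [(Nat.cast_nonneg n : (0 : ℝ) ≤ n)]
  have hb : ∀ n, ‖testJet b (φ n)‖ ≤ C + 1 := fun n => by
    have h2 := hφ n
    rw [dist_comm, dist_eq_norm] at h2
    have h3 := norm_le_insert' (testJet b (φ n)) (J n)
    linarith [hC n, hd1 n]
  obtain ⟨g, σ, hσ, hg⟩ := exists_subseq_testJet hb
  refine ⟨g, σ, hσ, ?_⟩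
  have h4 : Tendsto (fun n => (J (σ n)).val - (testJet b (φ (σ n))).val) atTop (𝓝 0) := by
    refine squeeze_zero_norm (fun n => ?_)
      ((tendsto_one_div_add_atTop_nhds_zero_nat (𝕜 := ℝ)).comp hσ.tendsto_atTop)
    have h5 := (hφ (σ n)).le
    rw [dist_eq_norm] at h5
    exact (norm_fst_le (J (σ n) - testJet b (φ (σ n)))).trans h5
  simpa using h4.add hg

/-! ### The convective terms -/

/-- The embedding of `H20` in the essentially bounded functions. -/
theorem exists_ae_bound (b : Periods) :
    ∃ C, 0 ≤ C ∧ ∀ J ∈ H20 b, ∀ᵐ x ∂cellMeasure b, |J.val x| ≤ C * ‖J‖ := by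
  obtain ⟨C, hC0, hC⟩ := exists_sup_bound b
  refine ⟨C, hC0, fun J hJ => ?_⟩
  obtain ⟨K, hK, hlim⟩ := mem_closure_iff_seq_limit.1 hJ
  choose φ hφ using hK
  obtain rfl : (fun n => testJet b (φ n)) = K := funext hφ
  have h1 : Tendsto (fun n => (testJet b (φ n)).val) atTop (𝓝 J.val) :=
    (continuous_val b).continuousAt.tendsto.comp hlim
  obtain ⟨σ, hσ, hae⟩ := (tendstoInMeasure_of_tendsto_Lp h1).exists_seq_tendsto_ae
  have h2 : ∀ᵐ x ∂cellMeasure b, ∀ n, (testJet b (φ (σ n))).val x = (φ (σ n)).1 x :=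
    ae_all_iff.2 fun n => (φ (σ n)).2.memLp.coeFn_toLp
  filter_upwards [hae, h2] with x hx hx2
  have h3 : Tendsto (fun n => C * ‖testJet b (φ (σ n))‖) atTop (𝓝 (C * ‖J‖)) :=
    ((hlim.comp hσ.tendsto_atTop).norm).const_mul C
  refine le_of_tendsto_of_tendsto hx.abs h3 (Eventually.of_forall fun n => ?_)
  change |(testJet b (φ (σ n))).val x| ≤ _
  rw [hx2 n]
  exact hC _ _

theorem integral_abs_mul_le {b : Periods} (f g : L2 b) :
    Integrable (fun x => |f x| * |g x|) (cellMeasure b) ∧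
      ∫ x in cell b, |f x| * |g x| ≤ ‖f‖ * ‖g‖ := by
  have hf := (Lp.memLp f).norm
  have hg := (Lp.memLp g).norm
  refine ⟨hf.integrable_mul hg, ?_⟩
  have h1 := inner_toLp hf hg
  simp only [Real.norm_eq_abs] at h1
  rw [← h1]
  refine (real_inner_le_norm _ _).trans (le_of_eq ?_)
  have hn : ∀ h : L2 b, eLpNorm (fun x => |h x|) 2 (cellMeasure b) = eLpNorm h 2 (cellMeasure b) :=
    fun h => eLpNorm_norm h
  rw [Lp.norm_toLp, Lp.norm_toLp, hn, hn, Lp.norm_def, Lp.norm_def]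

theorem integrable_triple {b : Periods} (f g : L2 b) {J : Jet b} (hJ : J ∈ H20 b) :
    Integrable (fun x => f x * g x * J.val x) (cellMeasure b) := by
  obtain ⟨C, hC0, hC⟩ := exists_ae_bound b
  refine ((integral_abs_mul_le f g).1.mul_const (C * ‖J‖)).mono' ?_ ?_
  · exact ((Lp.aestronglyMeasurable f).mul (Lp.aestronglyMeasurable g)).mul
      (Lp.aestronglyMeasurable J.val)
  · filter_upwards [hC J hJ] with x hx
    rw [Real.norm_eq_abs, abs_mul, abs_mul]
    exact mul_le_mul_of_nonneg_left hx (mul_nonneg (abs_nonneg _) (abs_nonneg _))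

/-- The trilinear form `∫ f g J` is bounded on `L² × L² × H²`. -/
theorem exists_triple_bound (b : Periods) :
    ∃ C, 0 ≤ C ∧ ∀ (f g : L2 b), ∀ J ∈ H20 b,
      |∫ x in cell b, f x * g x * J.val x| ≤ C * (‖f‖ * ‖g‖ * ‖J‖) := by
  obtain ⟨C, hC0, hC⟩ := exists_ae_bound b
  refine ⟨C, hC0, fun f g J hJ => ?_⟩
  obtain ⟨hi, hle⟩ := integral_abs_mul_le f g
  calc |∫ x in cell b, f x * g x * J.val x|
      ≤ ∫ x in cell b, |f x| * |g x| * (C * ‖J‖) := by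
        rw [← Real.norm_eq_abs]
        refine norm_integral_le_of_norm_le (hi.mul_const _) ?_
        filter_upwards [hC J hJ] with x hx
        rw [Real.norm_eq_abs, abs_mul, abs_mul]
        exact mul_le_mul_of_nonneg_left hx (mul_nonneg (abs_nonneg _) (abs_nonneg _))
    _ = (∫ x in cell b, |f x| * |g x|) * (C * ‖J‖) := integral_mul_const _ _
    _ ≤ ‖f‖ * ‖g‖ * (C * ‖J‖) :=
        mul_le_mul_of_nonneg_right hle (mul_nonneg hC0 (norm_nonneg _))
    _ = C * (‖f‖ * ‖g‖ * ‖J‖) := by ring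

theorem integral_triple_sub_left {b : Periods} (f f' g : L2 b) {J : Jet b} (hJ : J ∈ H20 b) :
    ∫ x in cell b, (f - f') x * g x * J.val x =
      (∫ x in cell b, f x * g x * J.val x) - ∫ x in cell b, f' x * g x * J.val x := by
  rw [← integral_sub (integrable_triple f g hJ) (integrable_triple f' g hJ)]
  refine integral_congr_ae ?_
  filter_upwards [Lp.coeFn_sub f f'] with x hx
  rw [hx, Pi.sub_apply]
  ring

theorem integral_triple_comm {b : Periods} (f g : L2 b) (J : Jet b) :
    ∫ x in cell b, f x * g x * J.val x = ∫ x in cell b, g x * f x * J.val x := by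
  simp only [mul_comm]

theorem integral_triple_sub_jet {b : Periods} (f g : L2 b) {J K : Jet b} (hJ : J ∈ H20 b)
    (hK : K ∈ H20 b) :
    ∫ x in cell b, f x * g x * (J - K).val x =
      (∫ x in cell b, f x * g x * J.val x) - ∫ x in cell b, f x * g x * K.val x := by
  rw [← integral_sub (integrable_triple f g hJ) (integrable_triple f g hK)]
  refine integral_congr_ae ?_
  filter_upwards [Lp.coeFn_sub J.val K.val] with x hx
  change f x * g x * (J.val - K.val) x = _
  rw [hx, Pi.sub_apply]
  ring

theorem H20_sub {b : Periods} {J K : Jet b} (hJ : J ∈ H20 b) (hK : K ∈ H20 b) : J - K ∈ H20 b :=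
  (H20Submodule b).sub_mem hJ hK

/-- Joint continuity of `(f, g, J) ↦ ∫ f g J` on `L² × L² × H²`. -/
theorem tendsto_integral_triple {b : Periods} {f g : ℕ → L2 b} {J : ℕ → Jet b} {f₀ g₀ : L2 b}
    {J₀ : Jet b} (hf : Tendsto f atTop (𝓝 f₀)) (hg : Tendsto g atTop (𝓝 g₀))
    (hJ : Tendsto J atTop (𝓝 J₀)) (hmem : ∀ n, J n ∈ H20 b) (hmem₀ : J₀ ∈ H20 b) :
    Tendsto (fun n => ∫ x in cell b, f n x * g n x * (J n).val x) atTop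
      (𝓝 (∫ x in cell b, f₀ x * g₀ x * J₀.val x)) := by
  obtain ⟨C, hC0, hC⟩ := exists_triple_bound b
  rw [tendsto_iff_norm_sub_tendsto_zero]
  have hlim : Tendsto (fun n => C * (‖f n - f₀‖ * ‖g n‖ * ‖J n‖) +
      C * (‖g n - g₀‖ * ‖f₀‖ * ‖J n‖) + C * (‖f₀‖ * ‖g₀‖ * ‖J n - J₀‖)) atTop (𝓝 0) := by
    have h1 := tendsto_iff_norm_sub_tendsto_zero.1 hf
    have h2 := tendsto_iff_norm_sub_tendsto_zero.1 hg
    have h3 := tendsto_iff_norm_sub_tendsto_zero.1 hJ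
    have := ((((h1.mul hg.norm).mul hJ.norm).const_mul C).add
      (((h2.mul_const ‖f₀‖).mul hJ.norm).const_mul C)).add
      ((h3.const_mul (‖f₀‖ * ‖g₀‖)).const_mul C)
    simpa using this
  refine squeeze_zero (fun n => norm_nonneg _) (fun n => ?_) hlim
  have e1 := integral_triple_sub_left (f n) f₀ (g n) (hmem n)
  have e2 := integral_triple_sub_left (g n) g₀ f₀ (hmem n)
  have e3 := integral_triple_sub_jet f₀ g₀ (hmem n) hmem₀
  rw [integral_triple_comm (g n) f₀, integral_triple_comm g₀ f₀] at e2
  have e4 : (∫ x in cell b, f n x * g n x * (J n).val x) - ∫ x in cell b, f₀ x * g₀ x * J₀.val x =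
      (∫ x in cell b, (f n - f₀) x * g n x * (J n).val x) +
      (∫ x in cell b, (g n - g₀) x * f₀ x * (J n).val x) +
      ∫ x in cell b, f₀ x * g₀ x * (J n - J₀).val x := by
    rw [e1, e2, e3]; ring
  rw [e4, Real.norm_eq_abs]
  exact (abs_add_three _ _ _).trans (add_le_add (add_le_add (hC _ _ _ (hmem n))
    (hC _ _ _ (hmem n))) (hC _ _ _ (H20_sub (hmem n) hmem₀)))

theorem exists_testJet_seq {b : Periods} {J : Jet b} (hJ : J ∈ H20 b) :
    ∃ φ : ℕ → testSpace b, Tendsto (fun n => testJet b (φ n)) atTop (𝓝 J) := by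
  obtain ⟨K, hK, hlim⟩ := mem_closure_iff_seq_limit.1 hJ
  choose φ hφ using hK
  exact ⟨φ, by simpa only [hφ] using hlim⟩

theorem integral_convection_test {b : Periods} (φ ψ : testSpace b) (j : Fin 3) :
    ∫ x in cell b, (testJet b φ).val x * (testJet b ψ).d j x * (testJet b ψ).val x =
      -(1 / 2) * ∫ x in cell b, (testJet b φ).d j x * (testJet b ψ).val x *
        (testJet b ψ).val x := by
  have h1 := φ.2.integral_mul_pderiv (ψ.2.mul ψ.2) j
  have e : ∀ x, pderiv j (fun x => ψ.1 x * ψ.1 x) x = 2 * (pderiv j ψ.1 x * ψ.1 x) := fun x => by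
    rw [pderiv_mul (ψ.2.differentiable x) (ψ.2.differentiable x)]; ring
  have i1 : ∫ x in cell b, (testJet b φ).val x * (testJet b ψ).d j x * (testJet b ψ).val x =
      ∫ x in cell b, φ.1 x * (pderiv j ψ.1 x * ψ.1 x) := by
    refine integral_congr_ae ?_
    filter_upwards [φ.2.memLp.coeFn_toLp, ψ.2.memLp.coeFn_toLp,
      (ψ.2.pderiv j).memLp.coeFn_toLp] with x h1 h2 h3
    rw [← h1, ← h2, ← h3, ← mul_assoc]
    rfl
  have i2 : ∫ x in cell b, (testJet b φ).d j x * (testJet b ψ).val x * (testJet b ψ).val x =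
      ∫ x in cell b, pderiv j φ.1 x * (ψ.1 x * ψ.1 x) := by
    refine integral_congr_ae ?_
    filter_upwards [(φ.2.pderiv j).memLp.coeFn_toLp, ψ.2.memLp.coeFn_toLp] with x h1 h2
    rw [← h1, ← h2, ← mul_assoc]
    rfl
  rw [i1, i2]
  have e2 : ∀ x, φ.1 x * pderiv j (fun x => ψ.1 x * ψ.1 x) x =
      2 * (φ.1 x * (pderiv j ψ.1 x * ψ.1 x)) := fun x => by rw [e]; ring
  simp only [e2] at h1
  rw [integral_const_mul] at h1
  linarith

/-- Since `φ ∂ⱼφ = ½ ∂ⱼ(φ²)`, integration by parts moves the derivative to the advecting field. -/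
theorem integral_convection {b : Periods} {J K : Jet b} (hJ : J ∈ H20 b) (hK : K ∈ H20 b)
    (j : Fin 3) :
    ∫ x in cell b, J.val x * K.d j x * K.val x =
      -(1 / 2) * ∫ x in cell b, J.d j x * K.val x * K.val x := by
  obtain ⟨φ, hφ⟩ := exists_testJet_seq hJ
  obtain ⟨ψ, hψ⟩ := exists_testJet_seq hK
  have v1 := (continuous_val b).continuousAt.tendsto.comp hφ
  have v2 := (continuous_val b).continuousAt.tendsto.comp hψ
  have d1 := (continuous_d b j).continuousAt.tendsto.comp hφ
  have d2 := (continuous_d b j).continuousAt.tendsto.comp hψ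
  have l1 := tendsto_integral_triple v1 d2 hψ (fun n => testJet_mem b _) hK
  have l2 := (tendsto_integral_triple d1 v2 hψ (fun n => testJet_mem b _) hK).const_mul (-(1 / 2))
  refine tendsto_nhds_unique l1 (l2.congr fun n => ?_)
  exact (integral_convection_test (φ n) (ψ n) j).symm

/-- Convection by a solenoidal field does not change the energy. -/
theorem sum_integral_convection_eq_zero {b : Periods} {u : Fin 3 → Jet b} {K : Jet b}
    (hu : ∀ i, u i ∈ H20 b) (hdiv : ∑ i, (u i).d i = 0) (hK : K ∈ H20 b) :
    ∑ j, ∫ x in cell b, (u j).val x * K.d j x * K.val x = 0 := by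
  simp only [integral_convection (hu _) hK]
  rw [← Finset.mul_sum, ← integral_finsetSum _ fun j _ => integrable_triple _ _ hK]
  rw [integral_eq_zero_of_ae, mul_zero]
  have h0 : ∀ᵐ x ∂cellMeasure b, ∑ j, (u j).d j x = 0 := by
    have h1 : ⇑(∑ i, (u i).d i) =ᵐ[cellMeasure b] 0 := by
      rw [hdiv]; exact Lp.coeFn_zero _ _ _
    filter_upwards [h1, Lp.coeFn_finsetSum Finset.univ fun i => (u i).d i] with x hx hx2
    rw [← Finset.sum_apply, ← hx2, hx]
    rfl
  filter_upwards [h0] with x hx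
  simp only [← Finset.sum_mul, hx, zero_mul, Pi.zero_apply]

/-! ### Maximizing a quotient of quadratic forms -/

/-- Direct method for a quotient `I / D` of quadratic forms, where `D` is coercive and bounded
sequences have subsequences along which `I` of the differences tends to zero. With `μ` the
supremum, `Q = μ D - I` is nonnegative and tends to zero along a normalized maximizing sequence;
by the parallelogram law so does `Q` of the differences, hence also `μ D`, and the sequence
converges in norm. -/
theorem exists_max_quotient {E : Type*} [NormedAddCommGroup E] [NormedSpace ℝ E] [CompleteSpace E]
    {S : Submodule ℝ E} (hS : IsClosed (S : Set E)) {D I : E → ℝ} (hDc : Continuous D)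
    (hIc : Continuous I) (hDs : ∀ (c : ℝ) x, D (c • x) = c ^ 2 * D x)
    (hIs : ∀ (c : ℝ) x, I (c • x) = c ^ 2 * I x)
    (hDp : ∀ x y, D (x + y) + D (x - y) = 2 * D x + 2 * D y)
    (hIp : ∀ x y, I (x + y) + I (x - y) = 2 * I x + 2 * I y)
    {c : ℝ} (hc : 0 < c) (hcoer : ∀ x ∈ S, c * ‖x‖ ^ 2 ≤ D x)
    {K : ℝ} (hbdd : ∀ x ∈ S, I x ≤ K * D x)
    (hcomp : ∀ (x : ℕ → E) (C : ℝ), (∀ n, x n ∈ S) → (∀ n, ‖x n‖ ≤ C) →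
      ∃ σ : ℕ → ℕ, StrictMono σ ∧
        ∀ ε > 0, ∃ N, ∀ m ≥ N, ∀ n ≥ N, I (x (σ m) - x (σ n)) ≤ ε)
    (hpos : ∃ x ∈ S, 0 < I x) :
    ∃ x ∈ S, x ≠ 0 ∧ 0 < I x / D x ∧ ∀ y ∈ S, y ≠ 0 → I y / D y ≤ I x / D x := by
  have hDpos : ∀ x ∈ S, x ≠ 0 → 0 < D x := fun x hx h0 =>
    lt_of_lt_of_le (mul_pos hc (pow_pos (norm_pos_iff.2 h0) 2)) (hcoer x hx)
  have hI0 : I 0 = 0 := by simpa using hIs 0 0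
  have hD0 : D 0 = 0 := by simpa using hDs 0 0
  set q : Set ℝ := {r | ∃ x ∈ S, x ≠ 0 ∧ r = I x / D x} with hq
  have hqb : BddAbove q := ⟨K, by
    rintro _ ⟨x, hx, h0, rfl⟩
    exact (div_le_iff₀ (hDpos x hx h0)).2 (hbdd x hx)⟩
  obtain ⟨x₁, hx₁, hIx₁⟩ := hpos
  have hx₁0 : x₁ ≠ 0 := by rintro rfl; exact hIx₁.ne' hI0
  have hqn : q.Nonempty := ⟨_, x₁, hx₁, hx₁0, rfl⟩
  set μ := sSup q with hμ
  have hμ0 : 0 < μ :=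
    (div_pos hIx₁ (hDpos x₁ hx₁ hx₁0)).trans_le (le_csSup hqb ⟨x₁, hx₁, hx₁0, rfl⟩)
  have hQ : ∀ x ∈ S, 0 ≤ μ * D x - I x := fun x hx => by
    by_cases h0 : x = 0
    · rw [h0, hI0, hD0]; simp
    · have h1 := le_csSup hqb ⟨x, hx, h0, rfl⟩
      rw [div_le_iff₀ (hDpos x hx h0)] at h1
      linarith
  have hseq : ∀ n : ℕ, ∃ x ∈ S, D x = 1 ∧ μ - 1 / ((n : ℝ) + 1) < I x := fun n => by
    obtain ⟨_, ⟨x, hx, h0, rfl⟩, hlt⟩ :=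
      exists_lt_of_lt_csSup hqn (sub_lt_self μ (Nat.one_div_pos_of_nat (n := n)))
    have hD := hDpos x hx h0
    have hs : (√(D x))⁻¹ ^ 2 = (D x)⁻¹ := by rw [inv_pow, Real.sq_sqrt hD.le]
    refine ⟨(√(D x))⁻¹ • x, S.smul_mem _ hx, ?_, ?_⟩
    · rw [hDs, hs, inv_mul_cancel₀ hD.ne']
    · rw [hIs, hs, inv_mul_eq_div]; exact hlt
  choose x hxS hxD hxI using hseq
  have hxb : ∀ n, ‖x n‖ ≤ √(1 / c) := fun n => by
    refine Real.le_sqrt_of_sq_le ?_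
    rw [le_div_iff₀ hc]
    have := hcoer _ (hxS n)
    rw [hxD] at this
    linarith
  obtain ⟨σ, hσ, hσI⟩ := hcomp x _ hxS hxb
  have hQn : ∀ n, μ * D (x n) - I (x n) ≤ 1 / ((n : ℝ) + 1) := fun n => by
    rw [hxD]; linarith [hxI n]
  have hsmall : Tendsto (fun n => 1 / ((σ n : ℝ) + 1)) atTop (𝓝 0) :=
    (tendsto_one_div_add_atTop_nhds_zero_nat (𝕜 := ℝ)).comp hσ.tendsto_atTop
  have hcau : CauchySeq fun n => x (σ n) := by
    refine Metric.cauchySeq_iff.2 fun ε hε => ?_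
    set δ := μ * c * ε ^ 2 / 6 with hδ
    have hδ0 : 0 < δ := by positivity
    obtain ⟨N₁, hN₁⟩ := hσI δ hδ0
    obtain ⟨N₂, hN₂⟩ := eventually_atTop.1 (hsmall.eventually_lt_const hδ0)
    refine ⟨max N₁ N₂, fun m hm n hn => ?_⟩
    have h1 := hN₁ m (le_of_max_le_left hm) n (le_of_max_le_left hn)
    have h2 := (hQn (σ m)).trans_lt (hN₂ m (le_of_max_le_right hm))
    have h3 := (hQn (σ n)).trans_lt (hN₂ n (le_of_max_le_right hn))
    have h4 := hQ _ (S.add_mem (hxS (σ m)) (hxS (σ n)))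
    have h5 := hDp (x (σ m)) (x (σ n))
    have h6 := hIp (x (σ m)) (x (σ n))
    have h7 := hcoer _ (S.sub_mem (hxS (σ m)) (hxS (σ n)))
    have h8 : μ * D (x (σ m) - x (σ n)) ≤ 2 * (μ * D (x (σ m)) - I (x (σ m))) +
        2 * (μ * D (x (σ n)) - I (x (σ n))) + I (x (σ m) - x (σ n)) := by
      have : D (x (σ m) - x (σ n)) =
        2 * D (x (σ m)) + 2 * D (x (σ n)) - D (x (σ m) + x (σ n)) := by linarith
      rw [this]
      linarith
    have h9 : μ * (c * ‖x (σ m) - x (σ n)‖ ^ 2) ≤ μ * D (x (σ m) - x (σ n)) :=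
      mul_le_mul_of_nonneg_left h7 hμ0.le
    have h10 : μ * c * ‖x (σ m) - x (σ n)‖ ^ 2 < μ * c * ε ^ 2 := by linarith
    rw [dist_eq_norm]
    exact lt_of_pow_lt_pow_left₀ 2 hε.le (lt_of_mul_lt_mul_left h10 (by positivity))
  obtain ⟨a, ha⟩ := cauchySeq_tendsto_of_complete hcau
  have haS : a ∈ S := hS.mem_of_tendsto ha (Eventually.of_forall fun n => hxS _)
  have haD : D a = 1 := by
    refine tendsto_nhds_unique (hDc.continuousAt.tendsto.comp ha) ?_
    simp only [Function.comp_def, hxD]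
    exact tendsto_const_nhds
  have ha0 : a ≠ 0 := by rintro rfl; rw [hD0] at haD; exact zero_ne_one haD
  have haI : μ ≤ I a := by
    have h1 : Tendsto (fun n => I (x (σ n)) + 1 / ((σ n : ℝ) + 1)) atTop (𝓝 (I a + 0)) :=
      (hIc.continuousAt.tendsto.comp ha).add hsmall
    rw [add_zero] at h1
    exact ge_of_tendsto h1 (Eventually.of_forall fun n => by linarith [hxI (σ n)])
  refine ⟨a, haS, ha0, ?_, fun y hy hy0 => ?_⟩
  · rw [haD, div_one]; exact hμ0.trans_le haI
  · rw [haD, div_one]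
    exact (le_csSup hqb ⟨y, hy, hy0, rfl⟩).trans haI

/-! ### The forms `D` and `I` -/

theorem contDiff_profile (κ : ℝ) : ContDiff ℝ ∞ (profile κ) := by
  unfold profile
  fun_prop

theorem profile_zero (κ : ℝ) : profile κ 0 = 0 := by
  simp [profile]

theorem exists_profile_bound (κ lam : ℝ) :
    ∃ B, 0 ≤ B ∧ ∀ z ∈ Set.Ioo (0 : ℝ) 1, |1 + lam * profile κ z| ≤ B := by
  have hc := (contDiff_profile κ).continuous
  obtain ⟨B, hB⟩ := (isCompact_Icc (a := (0 : ℝ)) (b := 1)).exists_bound_of_continuousOn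
    (f := fun z => 1 + lam * profile κ z) (by fun_prop)
  refine ⟨max B 0, le_max_right _ _, fun z hz => ?_⟩
  exact (hB z (Set.Ioo_subset_Icc_self hz)).trans (le_max_left _ _)

theorem aestronglyMeasurable_vertical {b : Periods} {m : ℝ → ℝ} (hm : Continuous m) :
    AEStronglyMeasurable (fun x : Point => m (x 2)) (cellMeasure b) :=
  (hm.comp (continuous_apply (2 : Fin 3))).aestronglyMeasurable

theorem weighted_integral_bound {b : Periods} {m : ℝ → ℝ} (hm : Continuous m) {B : ℝ}
    (hB : ∀ z ∈ Set.Ioo (0 : ℝ) 1, |m z| ≤ B) (f g : L2 b) :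
    Integrable (fun x => f x * (g x * m (x 2))) (cellMeasure b) ∧
      |∫ x in cell b, f x * (g x * m (x 2))| ≤ B * ‖f‖ * ‖g‖ := by
  obtain ⟨hi, hle⟩ := integral_abs_mul_le f g
  have hpt : ∀ᵐ x ∂cellMeasure b, ‖f x * (g x * m (x 2))‖ ≤ B * (|f x| * |g x|) := by
    filter_upwards [ae_restrict_mem (cell_measurableSet b)] with x hx
    rw [Real.norm_eq_abs, abs_mul, abs_mul]
    have h1 := mul_le_mul_of_nonneg_left (hB _ hx.2) (mul_nonneg (abs_nonneg (f x))
      (abs_nonneg (g x)))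
    linarith
  have hB0 : 0 ≤ B := (abs_nonneg _).trans (hB (1 / 2) (by norm_num))
  refine ⟨(hi.const_mul B).mono' ((Lp.aestronglyMeasurable f).mul
    ((Lp.aestronglyMeasurable g).mul (aestronglyMeasurable_vertical hm))) hpt, ?_⟩
  rw [← Real.norm_eq_abs]
  refine (norm_integral_le_of_norm_le (hi.const_mul B) hpt).trans ?_
  rw [integral_const_mul, mul_assoc]
  exact mul_le_mul_of_nonneg_left hle hB0

/-- The bounded bilinear form `(θ, w) ↦ (θ, w (1 + lam f))`. -/
theorem exists_production_form (b : Periods) (κ lam : ℝ) :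
    ∃ P : L2 b →L[ℝ] L2 b →L[ℝ] ℝ, ∀ f g,
      P f g = ∫ x in cell b, f x * (g x * (1 + lam * profile κ (x 2))) := by
  obtain ⟨B, hB0, hB⟩ := exists_profile_bound κ lam
  have hc : Continuous fun z => 1 + lam * profile κ z := by
    have := (contDiff_profile κ).continuous
    fun_prop
  have hbd := weighted_integral_bound (b := b) hc hB
  refine ⟨(LinearMap.mk₂ ℝ (fun f g : L2 b => ∫ x in cell b, f x *
    (g x * (1 + lam * profile κ (x 2)))) ?_ ?_ ?_ ?_).mkContinuous₂ B fun f g => (hbd f g).2,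
    fun f g => rfl⟩
  · intro f f' g
    rw [← integral_add (hbd f g).1 (hbd f' g).1]
    refine integral_congr_ae ?_
    filter_upwards [Lp.coeFn_add f f'] with x hx
    rw [hx, Pi.add_apply]; ring
  · intro c f g
    rw [smul_eq_mul, ← integral_const_mul]
    refine integral_congr_ae ?_
    filter_upwards [Lp.coeFn_smul c f] with x hx
    rw [hx, Pi.smul_apply, smul_eq_mul]; ring
  · intro f g g'
    rw [← integral_add (hbd f g).1 (hbd f g').1]
    refine integral_congr_ae ?_
    filter_upwards [Lp.coeFn_add g g'] with x hx
    rw [hx, Pi.add_apply]; ring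
  · intro c f g
    rw [smul_eq_mul, ← integral_const_mul]
    refine integral_congr_ae ?_
    filter_upwards [Lp.coeFn_smul c g] with x hx
    rw [hx, Pi.smul_apply, smul_eq_mul]; ring

/-- The admissible perturbations as a subspace. -/
noncomputable def HSubmodule (b : Periods) : Submodule ℝ (Field b) where
  carrier := H b
  zero_mem' := ⟨fun _ => (H20Submodule b).zero_mem, (H20Submodule b).zero_mem, by
    simp [Jet.d]⟩
  add_mem' := by
    rintro U W ⟨h1, h2, h3⟩ ⟨h1', h2', h3'⟩
    refine ⟨fun i => (H20Submodule b).add_mem (h1 i) (h1' i),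
      (H20Submodule b).add_mem h2 h2', ?_⟩
    change ∑ i, ((U.1 i).d i + (W.1 i).d i) = 0
    rw [Finset.sum_add_distrib, h3, h3', add_zero]
  smul_mem' := by
    rintro c U ⟨h1, h2, h3⟩
    refine ⟨fun i => (H20Submodule b).smul_mem c (h1 i), (H20Submodule b).smul_mem c h2, ?_⟩
    change ∑ i, (c • (U.1 i).d i) = 0
    rw [← Finset.smul_sum, h3, smul_zero]

theorem isClosed_H (b : Periods) : IsClosed (H b) := by
  have hc : ∀ i, Continuous fun U : Field b => U.1 i := fun i =>
    (continuous_apply i).comp continuous_fst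
  have e : H b = (⋂ i, (fun U : Field b => U.1 i) ⁻¹' H20 b) ∩
      ((fun U : Field b => U.2) ⁻¹' H20 b ∩ {U | ∑ i, (U.1 i).d i = 0}) := by
    ext U; simp [H]
  rw [e]
  refine (isClosed_iInter fun i => isClosed_closure.preimage (hc i)).inter
    ((isClosed_closure.preimage continuous_snd).inter (isClosed_eq ?_ continuous_const))
  exact continuous_finsetSum _ fun i _ => (continuous_d b i).comp (hc i)

theorem continuous_dissipation (b : Periods) (ξ κ lam : ℝ) :
    Continuous (dissipation (b := b) ξ κ lam) := by
  have hc : ∀ i, Continuous fun U : Field b => U.1 i := fun i =>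
    (continuous_apply i).comp continuous_fst
  have h2 : Continuous fun U : Field b => U.2 := continuous_snd
  have hd := continuous_d b
  have hl := continuous_lap b
  have d1 : ∀ i j, Continuous fun U : Field b => (U.1 i).d j := fun i j => (hd j).comp (hc i)
  have d2 : ∀ j, Continuous fun U : Field b => U.2.d j := fun j => (hd j).comp h2
  have l1 : ∀ i, Continuous fun U : Field b => (U.1 i).lap := fun i => hl.comp (hc i)
  have l2 : Continuous fun U : Field b => U.2.lap := hl.comp h2
  unfold dissipation
  fun_prop

theorem lap_add {b : Periods} (J K : Jet b) : (J + K).lap = J.lap + K.lap := by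
  simp [Jet.lap, Finset.sum_add_distrib]

theorem lap_sub {b : Periods} (J K : Jet b) : (J - K).lap = J.lap - K.lap := by
  simp [Jet.lap, Finset.sum_sub_distrib]

theorem lap_smul {b : Periods} (c : ℝ) (J : Jet b) : (c • J).lap = c • J.lap := by
  simp [Jet.lap, Finset.smul_sum]

theorem dissipation_smul {b : Periods} (ξ κ lam c : ℝ) (U : Field b) :
    dissipation ξ κ lam (c • U) = c ^ 2 * dissipation ξ κ lam U := by
  have e1 : ∀ (J : Jet b) j, ‖(c • J).d j‖ ^ 2 = c ^ 2 * ‖J.d j‖ ^ 2 := fun J j => by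
    change ‖c • J.d j‖ ^ 2 = _
    rw [norm_smul, mul_pow, Real.norm_eq_abs, sq_abs]
  have e2 : ∀ (J : Jet b), ‖(c • J).lap‖ ^ 2 = c ^ 2 * ‖J.lap‖ ^ 2 := fun J => by
    rw [lap_smul, norm_smul, mul_pow, Real.norm_eq_abs, sq_abs]
  simp only [dissipation, Prod.smul_fst, Prod.smul_snd, Pi.smul_apply, e1, e2, ← Finset.mul_sum]
  ring

theorem dissipation_parallelogram {b : Periods} (ξ κ lam : ℝ) (U W : Field b) :
    dissipation ξ κ lam (U + W) + dissipation ξ κ lam (U - W) =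
      2 * dissipation ξ κ lam U + 2 * dissipation ξ κ lam W := by
  have e0 : ∀ f g : L2 b, ‖f + g‖ ^ 2 = 2 * ‖f‖ ^ 2 + 2 * ‖g‖ ^ 2 - ‖f - g‖ ^ 2 := fun f g => by
    have := parallelogram_law_with_norm ℝ f g
    nlinarith
  have e1 : ∀ (J K : Jet b) j, ‖(J + K).d j‖ ^ 2 =
      2 * ‖J.d j‖ ^ 2 + 2 * ‖K.d j‖ ^ 2 - ‖(J - K).d j‖ ^ 2 := fun J K j => e0 (J.d j) (K.d j)
  have e2 : ∀ (J K : Jet b), ‖(J + K).lap‖ ^ 2 =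
      2 * ‖J.lap‖ ^ 2 + 2 * ‖K.lap‖ ^ 2 - ‖(J - K).lap‖ ^ 2 := fun J K => by
    rw [lap_add, lap_sub, e0]
  simp only [dissipation, Prod.fst_add, Prod.snd_add, Pi.add_apply, e1, e2, Prod.fst_sub,
    Prod.snd_sub, Pi.sub_apply, Finset.sum_sub_distrib, Finset.sum_add_distrib, ← Finset.mul_sum]
  ring

/-- Coercivity of the dissipation in the norm of `H²`. -/
theorem dissipation_coercive {b : Periods} {ξ κ lam : ℝ} (hξ : 0 < ξ) (hκ : 0 < κ)
    (hlam : 0 < lam) :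
    ∃ c, 0 < c ∧ ∀ U ∈ H b, c * ‖U‖ ^ 2 ≤ dissipation ξ κ lam U := by
  set c := min (min 1 ξ) (min lam (lam * κ)) with hc
  have hc0 : 0 < c := lt_min (lt_min one_pos hξ) (lt_min hlam (mul_pos hlam hκ))
  have c1 : c ≤ 1 := (min_le_left _ _).trans (min_le_left _ _)
  have c2 : c ≤ ξ := (min_le_left _ _).trans (min_le_right _ _)
  have c3 : c ≤ lam := (min_le_right _ _).trans (min_le_left _ _)
  have c4 : c ≤ lam * κ := (min_le_right _ _).trans (min_le_right _ _)
  refine ⟨c, hc0, fun U hU => ?_⟩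
  obtain ⟨h1, h2, -⟩ := hU
  obtain ⟨s₁, hs₁⟩ : ∃ s, s = ∑ i, ∑ j, ‖(U.1 i).d j‖ ^ 2 := ⟨_, rfl⟩
  obtain ⟨s₂, hs₂⟩ : ∃ s, s = ∑ i, ‖(U.1 i).lap‖ ^ 2 := ⟨_, rfl⟩
  obtain ⟨s₃, hs₃⟩ : ∃ s, s = ∑ j, ‖U.2.d j‖ ^ 2 := ⟨_, rfl⟩
  obtain ⟨s₄, hs₄⟩ : ∃ s, s = ‖U.2.lap‖ ^ 2 := ⟨_, rfl⟩
  have p1 : 0 ≤ s₁ := hs₁ ▸ Finset.sum_nonneg fun _ _ => Finset.sum_nonneg fun _ _ => sq_nonneg _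
  have p2 : 0 ≤ s₂ := hs₂ ▸ Finset.sum_nonneg fun _ _ => sq_nonneg _
  have p3 : 0 ≤ s₃ := hs₃ ▸ Finset.sum_nonneg fun _ _ => sq_nonneg _
  have p4 : 0 ≤ s₄ := hs₄ ▸ sq_nonneg _
  have hDs : c * (s₁ + s₂ + s₃ + s₄) ≤ dissipation ξ κ lam U := by
    rw [dissipation, ← hs₁, ← hs₂, ← hs₃, ← hs₄]
    linarith [mul_le_mul_of_nonneg_right c1 p1, mul_le_mul_of_nonneg_right c2 p2,
      mul_le_mul_of_nonneg_right c3 p3, mul_le_mul_of_nonneg_right c4 p4]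
  have hU1 : ∀ i, ‖U.1 i‖ ≤ √(s₁ + s₂ + s₃ + s₄) := fun i => by
    refine Real.le_sqrt_of_sq_le ((norm_sq_le (h1 i)).trans ?_)
    have q1 : ∑ j, ‖(U.1 i).d j‖ ^ 2 ≤ s₁ := by
      rw [hs₁]
      exact Finset.single_le_sum (f := fun i => ∑ j, ‖(U.1 i).d j‖ ^ 2)
        (fun _ _ => Finset.sum_nonneg fun _ _ => sq_nonneg _) (Finset.mem_univ i)
    have q2 : ‖(U.1 i).lap‖ ^ 2 ≤ s₂ := by
      rw [hs₂]
      exact Finset.single_le_sum (f := fun i => ‖(U.1 i).lap‖ ^ 2) (fun _ _ => sq_nonneg _)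
        (Finset.mem_univ i)
    linarith
  have hU2 : ‖U.2‖ ≤ √(s₁ + s₂ + s₃ + s₄) :=
    Real.le_sqrt_of_sq_le ((norm_sq_le h2).trans (by rw [← hs₃, ← hs₄]; linarith))
  have hUs : ‖U‖ ≤ √(s₁ + s₂ + s₃ + s₄) :=
    norm_prod_le_iff.2 ⟨(pi_norm_le_iff_of_nonneg (Real.sqrt_nonneg _)).2 hU1, hU2⟩
  have hUq : ‖U‖ ^ 2 ≤ s₁ + s₂ + s₃ + s₄ := by
    calc ‖U‖ ^ 2 ≤ √(s₁ + s₂ + s₃ + s₄) ^ 2 := by gcongr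
      _ = _ := Real.sq_sqrt (by positivity)
  exact (mul_le_mul_of_nonneg_left hUq hc0.le).trans hDs

theorem norm_val_le {b : Periods} (U : Field b) (i : Fin 3) : ‖(U.1 i).val‖ ≤ ‖U‖ :=
  (norm_fst_le (U.1 i)).trans ((norm_le_pi_norm U.1 i).trans (norm_fst_le U))

theorem norm_temp_le {b : Periods} (U : Field b) : ‖U.2.val‖ ≤ ‖U‖ :=
  (norm_fst_le U.2).trans (norm_snd_le U)

/-! ### A perturbation with positive production -/

/-- A test function of mean square zero vanishes identically. -/
theorem IsTest.eq_zero_of_integral_sq {b : Periods} {F : Point → ℝ} (h : IsTest b F)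
    (h0 : ∫ x in cell b, F x ^ 2 = 0) : F = 0 := by
  have h1 : (fun x => F x ^ 2) =ᵐ[cellMeasure b] 0 :=
    (integral_eq_zero_iff_of_nonneg (fun x => sq_nonneg _) h.memLp.integrable_sq).1 h0
  set A : Set Point := {x | F x ≠ 0} with hA
  have hopen : IsOpen A := isOpen_ne_fun h.continuous continuous_const
  have hcell : volume (A ∩ column b) = 0 := by
    have h2 : volume (A ∩ cell b) = 0 := by
      have h3 : ∀ᵐ x ∂cellMeasure b, x ∉ A := by
        filter_upwards [h1] with x hx
        simpa [hA] using hx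
      have h4 : cellMeasure b A = 0 := by
        simpa only [not_not, Set.ofPred_mem_eq] using ae_iff.1 h3
      rwa [Measure.restrict_apply hopen.measurableSet] at h4
    refine measure_mono_null ?_ h2
    rintro x ⟨hxA, hx⟩
    refine ⟨hxA, hx, ?_⟩
    by_contra hz
    exact hxA (h.eq_zero hz)
  have hA0 : volume A = 0 := by
    refine (isAddFundamentalDomain_column_zero b).measure_zero_of_invariant A (fun g => ?_) hcell
    ext x
    rw [Set.mem_vadd_set_iff_neg_vadd_mem]
    have h5 := h.isPeriodic _ (-g).2 x
    change F (-g +ᵥ x) ≠ 0 ↔ F x ≠ 0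
    rw [show F (-g +ᵥ x) = F x from h5]
  have hAe : A = ∅ := (hopen.measure_eq_zero_iff volume).1 hA0
  ext x
  by_contra hx
  have : x ∈ A := hx
  rw [hAe] at this
  exact this

/-- The partial derivative of a test function, as a test function. -/
noncomputable def testPderiv {b : Periods} (i : Fin 3) (φ : testSpace b) : testSpace b :=
  ⟨pderiv i φ.1, φ.2.pderiv i⟩

theorem testPderiv_d_comm {b : Periods} (φ : testSpace b) (i j : Fin 3) :
    (testJet b (testPderiv i φ)).d j = (testJet b (testPderiv j φ)).d i := by
  refine MemLp.toLp_congr ((φ.2.pderiv i).pderiv j).memLp ((φ.2.pderiv j).pderiv i).memLp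
    (Eventually.of_forall fun x => ?_)
  exact congrFun (φ.2.pderiv_comm j i) x

/-- The solenoidal velocity `(a₀ ∂ψ/∂z, a₁ ∂ψ/∂z, -(a·∇)ψ)` of a stream function `ψ`. -/
noncomputable def streamVelocity {b : Periods} (a : Fin 2 → ℝ) (ψ : testSpace b) :
    Fin 3 → testSpace b :=
  ![a 0 • testPderiv 2 ψ, a 1 • testPderiv 2 ψ,
    -(a 0 • testPderiv 0 ψ + a 1 • testPderiv 1 ψ)]

theorem streamVelocity_div {b : Periods} (a : Fin 2 → ℝ) (ψ : testSpace b) :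
    ∑ i, (testJet b (streamVelocity a ψ i)).d i = 0 := by
  have hd : ∀ (φ χ : testSpace b) (c e : ℝ) j, (testJet b (c • φ + e • χ)).d j =
      c • (testJet b φ).d j + e • (testJet b χ).d j := fun φ χ c e j => by
    change (testJetHom b (c • φ + e • χ)).d j = _
    rw [map_add, map_smul, map_smul]
    rfl
  have hs : ∀ (φ : testSpace b) (c : ℝ) j, (testJet b (c • φ)).d j = c • (testJet b φ).d j :=
    fun φ c j => by
      change (testJetHom b (c • φ)).d j = _
      rw [map_smul]
      rfl
  have hn : ∀ (φ : testSpace b) j, (testJet b (-φ)).d j = -(testJet b φ).d j := fun φ j => by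
    change (testJetHom b (-φ)).d j = _
    rw [map_neg]
    rfl
  rw [Fin.sum_univ_three]
  change (testJet b (a 0 • testPderiv 2 ψ)).d 0 + (testJet b (a 1 • testPderiv 2 ψ)).d 1 +
    (testJet b (-(a 0 • testPderiv 0 ψ + a 1 • testPderiv 1 ψ))).d 2 = 0
  rw [hn, hd, hs, hs, testPderiv_d_comm ψ 2 0, testPderiv_d_comm ψ 2 1]
  abel

/-- The stream function `sin (2πℓ) χ(z)`, where `ℓ` is the coordinate along the first period. -/
theorem exists_stream_function (b : Periods) {z₀ : ℝ} (hz : z₀ ∈ Set.Ioo (0 : ℝ) 1) :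
    ∃ ψ : testSpace b, fderiv ℝ ψ.1 ![0, 0, z₀] (horiz (b 0)) ≠ 0 := by
  set r := min z₀ (1 - z₀) with hr
  have hr0 : 0 < r := lt_min hz.1 (by linarith [hz.2])
  have hrl : r ≤ z₀ := min_le_left _ _
  have hru : r ≤ 1 - z₀ := min_le_right _ _
  let χ : ContDiffBump z₀ := ⟨r / 4, r / 2, by linarith, by linarith⟩
  have hχs : ContDiff ℝ ∞ χ := χ.contDiff
  let ℓ : (Fin 2 → ℝ) →L[ℝ] ℝ := LinearMap.toContinuousLinearMap (b.coord 0)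
  have hℓ : ∀ i, ℓ (b i) = if i = 0 then 1 else 0 := fun i => by
    change b.repr (b i) 0 = _
    rw [b.repr_self, Finsupp.single_apply]
  have hch : ContDiff ℝ ∞ fun x : Point => (![x 0, x 1] : Fin 2 → ℝ) := by
    refine contDiff_pi.2 fun i => ?_
    fin_cases i
    · exact contDiff_apply ℝ ℝ (0 : Fin 3)
    · exact contDiff_apply ℝ ℝ (1 : Fin 3)
  have hadd : ∀ (x : Point) (a : Fin 2 → ℝ), (![(x + horiz a) 0, (x + horiz a) 1] : Fin 2 → ℝ) =
      ![x 0, x 1] + a := fun x a => by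
    ext i; fin_cases i <;> simp [horiz]
  have htest : IsTest b fun x => Real.sin (2 * Real.pi * ℓ ![x 0, x 1]) * χ (x 2) := by
    refine ⟨?_, fun i x => ?_, z₀ - r / 2, z₀ + r / 2, by linarith, by linarith, fun x hx => ?_⟩
    · refine ContDiff.mul ?_ (hχs.comp (contDiff_apply ℝ ℝ (2 : Fin 3)))
      exact Real.contDiff_sin.comp (contDiff_const.mul (ℓ.contDiff.comp hch))
    · rw [hadd, map_add, hℓ]
      have e2 : (x + horiz (b i)) 2 = x 2 := by simp [horiz]
      rw [e2, mul_add]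
      split_ifs
      · rw [mul_one, Real.sin_add_two_pi]
      · rw [mul_zero, add_zero]
    · have h1 : χ (x 2) = 0 := by
        refine χ.zero_of_le_dist ?_
        by_contra hlt
        rw [not_le, Real.dist_eq, abs_lt] at hlt
        have hout : χ.rOut = r / 2 := rfl
        rw [hout] at hlt
        exact hx ⟨by linarith [hlt.1], by linarith [hlt.2]⟩
      simp [h1]
  -- along the first period through `(0, 0, z₀)` the function is `t ↦ sin (2πt)`
  refine ⟨⟨_, htest⟩, ?_⟩
  have h1 := (htest.differentiable ![0, 0, z₀]).hasFDerivAt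
  have h2 : HasDerivAt (fun t : ℝ => (![0, 0, z₀] : Point) + t • horiz (b 0)) (horiz (b 0)) 0 := by
    simpa using ((hasDerivAt_id (0 : ℝ)).smul_const (horiz (b 0))).const_add (![0, 0, z₀] : Point)
  have h1' : HasFDerivAt (fun x : Point => Real.sin (2 * Real.pi * ℓ ![x 0, x 1]) * χ (x 2))
    (fderiv ℝ (fun x : Point => Real.sin (2 * Real.pi * ℓ ![x 0, x 1]) * χ (x 2)) ![0, 0, z₀])
    ((![0, 0, z₀] : Point) + (0 : ℝ) • horiz (b 0)) := by rw [zero_smul, add_zero]; exact h1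
  have h3 := h1'.comp_hasDerivAt (0 : ℝ) h2
  have h4 : ∀ t : ℝ, Real.sin (2 * Real.pi * ℓ
      ![((![0, 0, z₀] : Point) + t • horiz (b 0)) 0, ((![0, 0, z₀] : Point) + t • horiz (b 0)) 1]) *
      χ (((![0, 0, z₀] : Point) + t • horiz (b 0)) 2) = Real.sin (2 * Real.pi * t) := fun t => by
    have e1 : t • horiz (b 0) = horiz (t • b 0) := (horizHom.map_smul t (b 0)).symm
    have e2 : (![(![0, 0, z₀] : Point) 0, (![0, 0, z₀] : Point) 1] : Fin 2 → ℝ) = 0 := by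
      ext i; fin_cases i <;> simp
    have e3 : ((![0, 0, z₀] : Point) + horiz (t • b 0)) 2 = z₀ := by
      change z₀ + 0 = z₀
      exact add_zero _
    rw [e1, hadd, e2, zero_add, map_smul, hℓ, e3,
      χ.one_of_mem_closedBall (Metric.mem_closedBall_self χ.rIn_pos.le)]
    simp
  have h5 : HasDerivAt (fun t : ℝ => Real.sin (2 * Real.pi * t)) (2 * Real.pi) 0 := by
    have e0 : HasDerivAt (fun t : ℝ => 2 * Real.pi * t) (2 * Real.pi) 0 := by
      simpa using (hasDerivAt_id (0 : ℝ)).const_mul (2 * Real.pi)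
    simpa using e0.sin
  have h6 := h3.unique (h5.congr_of_eventuallyEq (Eventually.of_forall h4))
  rw [h6]
  positivity

theorem exists_production_pos (b : Periods) (κ lam : ℝ) :
    ∃ U ∈ H b, 0 < production κ lam U := by
  set m : ℝ → ℝ := fun z => 1 + lam * profile κ z with hm
  have hms : ContDiff ℝ ∞ m := contDiff_const.add (contDiff_const.mul (contDiff_profile κ))
  -- near the lower plane the weight is close to `1`, because `f` vanishes there
  obtain ⟨z₀, hz₀, hmz⟩ : ∃ z₀ ∈ Set.Ioo (0 : ℝ) 1, m z₀ ≠ 0 := by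
    have h1 : ∀ᶠ z in 𝓝[>] (0 : ℝ), m z ≠ 0 :=
      (hms.continuous.continuousAt.eventually_ne (by simp [hm, profile_zero])).filter_mono
        nhdsWithin_le_nhds
    have h2 : ∀ᶠ z in 𝓝[>] (0 : ℝ), z ∈ Set.Ioo (0 : ℝ) 1 := Ioo_mem_nhdsGT one_pos
    obtain ⟨z, hz1, hz2⟩ := (h1.and h2).exists
    exact ⟨z, hz2, hz1⟩
  obtain ⟨ψ, hψ⟩ := exists_stream_function b hz₀
  set u := streamVelocity (b 0) ψ with hu
  have hw : ∀ x, (u 2).1 x = -fderiv ℝ ψ.1 x (horiz (b 0)) := fun x => by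
    rw [fderiv_apply_eq_sum, Fin.sum_univ_three]
    change -(b 0 0 * pderiv 0 ψ.1 x + b 0 1 * pderiv 1 ψ.1 x) =
      -(b 0 0 * pderiv 0 ψ.1 x + b 0 1 * pderiv 1 ψ.1 x + 0 * pderiv 2 ψ.1 x)
    ring
  -- with `θ = (1 + lam f) w` the production is the integral of a square
  have hθ : IsTest b fun x => m (x 2) * (u 2).1 x :=
    (u 2).2.mul_vertical fun z _ => hms.contDiffAt
  refine ⟨(fun i => testJet b (u i), testJet b ⟨_, hθ⟩), ⟨fun i => testJet_mem b _,
    testJet_mem b _, streamVelocity_div (b 0) ψ⟩, ?_⟩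
  have hI : production κ lam ((fun i => testJet b (u i), testJet b ⟨_, hθ⟩) : Field b) =
      ∫ x in cell b, (m (x 2) * (u 2).1 x) ^ 2 := by
    refine integral_congr_ae ?_
    filter_upwards [hθ.memLp.coeFn_toLp, (u 2).2.memLp.coeFn_toLp] with x h1 h2
    change hθ.memLp.toLp _ x * ((u 2).2.memLp.toLp _ x * m (x 2)) = _
    rw [h1, h2]
    ring
  rw [hI]
  refine lt_of_le_of_ne (integral_nonneg fun x => sq_nonneg _) fun h0 => ?_
  have h1 := congrFun (hθ.eq_zero_of_integral_sq h0.symm) ![0, 0, z₀]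
  simp only [hw, Pi.zero_apply] at h1
  exact mul_ne_zero hmz (neg_ne_zero.2 hψ) h1

/-! ### The threshold -/

theorem exists_max_production (b : Periods) {ξ κ lam : ℝ} (hξ : 0 < ξ) (hκ : 0 < κ)
    (hlam : 0 < lam) :
    ∃ U ∈ H b, U ≠ 0 ∧ 0 < production κ lam U / dissipation ξ κ lam U ∧
      ∀ W ∈ H b, W ≠ 0 → production κ lam W / dissipation ξ κ lam W ≤
        production κ lam U / dissipation ξ κ lam U := by
  obtain ⟨P, hP⟩ := exists_production_form b κ lam
  have hI : ∀ U : Field b, production κ lam U = P U.2.val (U.1 2).val := fun U => (hP _ _).symm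
  have hPb : ∀ f g, P f g ≤ ‖P‖ * ‖f‖ * ‖g‖ := fun f g =>
    (le_abs_self _).trans (P.le_opNorm₂ f g)
  obtain ⟨c, hc0, hc⟩ := dissipation_coercive (b := b) hξ hκ hlam
  refine exists_max_quotient (S := HSubmodule b) (isClosed_H b)
    (continuous_dissipation b ξ κ lam) ?_ (dissipation_smul ξ κ lam) ?_
    (dissipation_parallelogram ξ κ lam) ?_ hc0 hc (K := ‖P‖ / c) ?_ ?_
    (exists_production_pos b κ lam)
  · have h1 : Continuous fun U : Field b => P U.2.val := P.continuous.comp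
      ((continuous_val b).comp continuous_snd)
    have h2 : Continuous fun U : Field b => (U.1 2).val :=
      (continuous_val b).comp ((continuous_apply 2).comp continuous_fst)
    exact (h1.clm_apply h2).congr fun U => (hI U).symm
  · intro a U
    rw [hI, hI]
    change P (a • U.2.val) (a • (U.1 2).val) = _
    simp only [map_smul, _root_.smul_apply, smul_eq_mul]
    ring
  · intro U W
    simp only [hI]
    change P (U.2.val + W.2.val) ((U.1 2).val + (W.1 2).val) +
      P (U.2.val - W.2.val) ((U.1 2).val - (W.1 2).val) = _
    simp only [map_add, map_sub, _root_.add_apply, _root_.sub_apply]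
    ring
  · intro U hU
    have h1 := hc U hU
    calc production κ lam U ≤ ‖P‖ * ‖U.2.val‖ * ‖(U.1 2).val‖ := by rw [hI]; exact hPb _ _
      _ ≤ ‖P‖ * ‖U‖ * ‖U‖ := by
          gcongr
          · exact norm_temp_le U
          · exact norm_val_le U 2
      _ = ‖P‖ / c * (c * ‖U‖ ^ 2) := by field_simp
      _ ≤ ‖P‖ / c * dissipation ξ κ lam U := by gcongr
  · intro U C hU hC
    have hC0 : 0 ≤ C := (norm_nonneg _).trans (hC 0)
    obtain ⟨g, σ, hσ, hg⟩ := exists_subseq_val (fun n => (hU n).2.1)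
      (fun n => (norm_snd_le (U n)).trans (hC n))
    refine ⟨σ, hσ, fun ε hε => ?_⟩
    set M := ‖P‖ * (2 * C) + 1 with hM
    have hM0 : 0 < M := by positivity
    obtain ⟨N, hN⟩ := Metric.cauchySeq_iff.1 hg.cauchySeq (ε / M) (div_pos hε hM0)
    refine ⟨N, fun k hk n hn => ?_⟩
    have h1 := (hN k hk n hn).le
    rw [dist_eq_norm] at h1
    have h2 : ‖(U (σ k)).2.val - (U (σ n)).2.val‖ * M ≤ ε := (le_div_iff₀ hM0).1 h1
    have h3 : ‖((U (σ k) - U (σ n)).1 2).val‖ ≤ 2 * C :=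
      (norm_val_le _ 2).trans ((norm_sub_le _ _).trans (by linarith [hC (σ k), hC (σ n)]))
    rw [hI]
    refine (hPb _ _).trans ?_
    change ‖P‖ * ‖(U (σ k)).2.val - (U (σ n)).2.val‖ * ‖((U (σ k) - U (σ n)).1 2).val‖ ≤ ε
    have h4 := norm_nonneg ((U (σ k)).2.val - (U (σ n)).2.val)
    calc _ ≤ ‖P‖ * ‖(U (σ k)).2.val - (U (σ n)).2.val‖ * (2 * C) := by gcongr
      _ ≤ ‖(U (σ k)).2.val - (U (σ n)).2.val‖ * M := by rw [hM]; nlinarith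
      _ ≤ ε := h2

/-! ### The energy identity -/

theorem production_eq {b : Periods} (κ lam : ℝ) (U : Field b) :
    production κ lam U = inner ℝ U.2.val (U.1 2).val +
      lam * ∫ x in cell b, profile κ (x 2) * (U.1 2).val x * U.2.val x := by
  obtain ⟨B, -, hB⟩ := exists_profile_bound κ 1
  have hpc := (contDiff_profile κ).continuous
  have hi := (weighted_integral_bound (b := b) hpc (B := B + 1) (fun z hz => by
    have h1 := hB z hz
    rw [abs_le] at h1 ⊢
    exact ⟨by linarith [h1.1], by linarith [h1.2]⟩) U.2.val (U.1 2).val).1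
  have hi1 := (weighted_integral_bound (b := b) (m := fun _ => 1) continuous_const (B := 1)
    (fun z _ => by simp) U.2.val (U.1 2).val).1
  have e0 : (inner ℝ U.2.val (U.1 2).val : ℝ) =
      ∫ x in cell b, U.2.val x * ((U.1 2).val x * 1) := by
    rw [L2.inner_def]
    refine integral_congr_ae (Eventually.of_forall fun x => ?_)
    simp [mul_comm]
  rw [e0, ← integral_const_mul, production, ← integral_add hi1]
  · refine integral_congr_ae (Eventually.of_forall fun x => ?_)
    ring_nf
  · refine (hi.const_mul lam).congr (Eventually.of_forall fun x => ?_)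
    ring_nf

theorem hasDerivAt_energy {b : Periods} (Pr lam : ℝ) {U : ℝ → Field b} {t : ℝ}
    {ut : Fin 3 → L2 b} {θt : L2 b}
    (hu : ∀ i, HasDerivAt (fun τ => ((U τ).1 i).val) (ut i) t)
    (hθ : HasDerivAt (fun τ => (U τ).2.val) θt t) :
    HasDerivAt (fun τ => energy Pr lam (U τ))
      (∑ i, inner ℝ (ut i) ((U t).1 i).val + lam * Pr * inner ℝ θt (U t).2.val) t := by
  have h1 : HasDerivAt (fun τ => ∑ i, ‖((U τ).1 i).val‖ ^ 2)
      (∑ i, 2 * inner ℝ ((U t).1 i).val (ut i)) t :=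
    HasDerivAt.fun_sum fun i _ => (hu i).norm_sq
  have h2 : HasDerivAt (fun τ => ‖(U τ).2.val‖ ^ 2) (2 * inner ℝ (U t).2.val θt) t := hθ.norm_sq
  refine ((h1.const_mul (1 / 2)).add (h2.const_mul (lam * Pr / 2))).congr_deriv ?_
  rw [← Finset.mul_sum, real_inner_comm θt]
  simp only [real_inner_comm (ut _)]
  ring

/-- Testing the equations with the perturbation itself: the convective terms drop out. -/
theorem energy_identity {b : Periods} {ξ κ Pr R : ℝ} (lam : ℝ) {U : Field b} (hU : U ∈ H b)
    {ut : Fin 3 → L2 b} {θt : L2 b} (h : PerturbationEquations ξ κ Pr R U ut θt) :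
    ∑ i, inner ℝ (ut i) (U.1 i).val + lam * Pr * inner ℝ θt U.2.val =
      R * production κ lam U - dissipation ξ κ lam U := by
  obtain ⟨h1, h2⟩ := h U hU
  have c1 : ∑ i, ∑ j, ∫ x in cell b, (U.1 j).val x * (U.1 i).d j x * (U.1 i).val x = 0 :=
    Finset.sum_eq_zero fun i _ => sum_integral_convection_eq_zero hU.1 hU.2.2 (hU.1 i)
  have c2 := sum_integral_convection_eq_zero hU.1 hU.2.2 hU.2.1
  rw [c1, add_zero] at h1
  rw [c2, add_zero] at h2
  rw [production_eq, dissipation, mul_assoc, h1, h2]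
  simp only [real_inner_self_eq_norm_sq]
  ring

/-- The dissipation dominates `k` times the energy. -/
theorem decayRate_mul_energy_le {b : Periods} {ξ κ Pr lam : ℝ} (hξ : 0 < ξ) (hκ : 0 < κ)
    (hPr : 0 < Pr) (hlam : 0 < lam) {U : Field b} (hU : U ∈ H b) :
    decayRate ξ κ Pr * energy Pr lam U ≤ dissipation ξ κ lam U := by
  obtain ⟨h1, h2, -⟩ := hU
  set k := decayRate ξ κ Pr with hk
  have k1 : k ≤ 2 * Real.pi ^ 2 * (1 + ξ * Real.pi ^ 2) := min_le_left _ _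
  have k2 : k ≤ 2 * Real.pi ^ 2 / Pr * (1 + κ * Real.pi ^ 2) := min_le_right _ _
  have k3 : k * Pr ≤ 2 * Real.pi ^ 2 * (1 + κ * Real.pi ^ 2) := by
    calc k * Pr ≤ 2 * Real.pi ^ 2 / Pr * (1 + κ * Real.pi ^ 2) * Pr := by gcongr
      _ = _ := by field_simp
  have hJ : ∀ {J : Jet b} {c a : ℝ}, J ∈ H20 b → 0 < c →
      a ≤ 2 * Real.pi ^ 2 * (1 + c * Real.pi ^ 2) →
      a / 2 * ‖J.val‖ ^ 2 ≤ ∑ j, ‖J.d j‖ ^ 2 + c * ‖J.lap‖ ^ 2 := fun {J c a} hJ hc ha => by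
    have e1 := sum_norm_d_sq_ge hJ
    have e2 := mul_le_mul_of_nonneg_left (norm_lap_sq_ge hJ) hc.le
    have e3 := mul_le_mul_of_nonneg_right ha (sq_nonneg ‖J.val‖)
    linarith
  have s1 : k / 2 * ∑ i, ‖(U.1 i).val‖ ^ 2 ≤
      ∑ i, ∑ j, ‖(U.1 i).d j‖ ^ 2 + ξ * ∑ i, ‖(U.1 i).lap‖ ^ 2 := by
    rw [Finset.mul_sum, Finset.mul_sum, ← Finset.sum_add_distrib]
    exact Finset.sum_le_sum fun i _ => hJ (h1 i) hξ k1
  have s2 := mul_le_mul_of_nonneg_left (hJ h2 hκ k3) hlam.le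
  rw [energy, dissipation]
  linarith

/-! ### Decay of the energy -/

theorem absolutelyContinuousOnInterval_norm {X : Type*} [NormedAddCommGroup X] {f : ℝ → X}
    {s t : ℝ} (hf : AbsolutelyContinuousOnInterval f s t) :
    AbsolutelyContinuousOnInterval (fun τ => ‖f τ‖) s t := by
  refine squeeze_zero (fun E => Finset.sum_nonneg fun i _ => dist_nonneg) (fun E => ?_) hf
  refine Finset.sum_le_sum fun i _ => ?_
  rw [Real.dist_eq, dist_eq_norm]
  exact abs_norm_sub_norm_le _ _

theorem absolutelyContinuous_energy {b : Periods} (Pr lam : ℝ) {U : ℝ → Field b} {s t : ℝ}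
    (hu : ∀ i, AbsolutelyContinuousOnInterval (fun τ => ((U τ).1 i).val) s t)
    (hθ : AbsolutelyContinuousOnInterval (fun τ => (U τ).2.val) s t) :
    AbsolutelyContinuousOnInterval (fun τ => energy Pr lam (U τ)) s t := by
  have hsq : ∀ {f : ℝ → L2 b}, AbsolutelyContinuousOnInterval f s t →
      AbsolutelyContinuousOnInterval (fun τ => ‖f τ‖ ^ 2) s t := fun {f} hf => by
    have h1 := absolutelyContinuousOnInterval_norm hf
    simpa only [sq] using h1.fun_mul h1
  have h3 : AbsolutelyContinuousOnInterval (fun τ => ∑ i, ‖((U τ).1 i).val‖ ^ 2) s t := by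
    simp only [Fin.sum_univ_three]
    exact ((hsq (hu 0)).fun_add (hsq (hu 1))).fun_add (hsq (hu 2))
  exact (h3.const_mul (1 / 2)).fun_add ((hsq hθ).const_mul (lam * Pr / 2))

theorem continuousOn_energy {b : Periods} (Pr lam : ℝ) {U : ℝ → Field b} {s : Set ℝ}
    (hu : ∀ i, ContinuousOn (fun τ => ((U τ).1 i).val) s)
    (hθ : ContinuousOn (fun τ => (U τ).2.val) s) :
    ContinuousOn (fun τ => energy Pr lam (U τ)) s :=
  (continuousOn_const.mul (continuousOn_finsetSum _ fun i _ => (hu i).norm.pow 2)).add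
    (continuousOn_const.mul (hθ.norm.pow 2))

/-- Grönwall's inequality for functions that are absolutely continuous away from `0`: the function
`exp (ct) E(t)` is nonincreasing. -/
theorem le_exp_mul_of_ae_deriv_le {E : ℝ → ℝ} {c : ℝ} (hcont : ContinuousOn E (Set.Ici 0))
    (hac : ∀ s t : ℝ, 0 < s → s ≤ t → AbsolutelyContinuousOnInterval E s t)
    (hder : ∀ᵐ t ∂volume.restrict (Set.Ioi (0 : ℝ)), ∃ e, HasDerivAt E e t ∧ e ≤ -c * E t)
    {t : ℝ} (ht : 0 ≤ t) : E t ≤ Real.exp (-(c * t)) * E 0 := by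
  rcases ht.eq_or_lt with rfl | ht0
  · simp
  set g : ℝ → ℝ := fun τ => Real.exp (c * τ) * E τ with hg
  have hmono : ∀ s, 0 < s → s ≤ t → g t ≤ g s := fun s hs hst => by
    have hexp : AbsolutelyContinuousOnInterval (fun τ => Real.exp (c * τ)) s t :=
      ContDiffOn.absolutelyContinuousOnInterval (by fun_prop)
    have h1 := (hexp.fun_mul (hac s t hs hst)).integral_deriv_eq_sub
    have h2 : ∫ τ in s..t, deriv (fun x => Real.exp (c * x) * E x) τ ≤ 0 := by
      rw [intervalIntegral.integral_of_le hst]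
      refine integral_nonpos_of_ae ?_
      have hsub : Set.Ioc s t ⊆ Set.Ioi 0 := fun τ hτ => hs.trans hτ.1
      filter_upwards [ae_restrict_of_ae_restrict_of_subset hsub hder] with τ hτ
      obtain ⟨e, he, hle⟩ := hτ
      have e0 : HasDerivAt (fun τ : ℝ => c * τ) c τ := by
        simpa using (hasDerivAt_id τ).const_mul c
      rw [(e0.exp.fun_mul he).deriv]
      have := mul_le_mul_of_nonneg_left hle (Real.exp_pos (c * τ)).le
      simp only [Pi.zero_apply]
      linarith
    rw [h1] at h2
    exact sub_nonpos.1 h2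
  have hlim : Tendsto g (𝓝[>] 0) (𝓝 (g 0)) := by
    have h1 : ContinuousOn g (Set.Ici 0) := ContinuousOn.mul (by fun_prop) hcont
    exact (h1 0 Set.self_mem_Ici).mono_left (nhdsWithin_mono _ Set.Ioi_subset_Ici_self)
  have hle : g t ≤ g 0 := by
    refine ge_of_tendsto hlim ?_
    filter_upwards [Ioc_mem_nhdsGT ht0] with s hs using hmono s hs.1 hs.2
  have hg0 : g 0 = E 0 := by simp [hg]
  rw [hg0] at hle
  calc E t = Real.exp (-(c * t)) * g t := by
        rw [hg, ← mul_assoc, ← Real.exp_add]; simp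
    _ ≤ _ := mul_le_mul_of_nonneg_left hle (Real.exp_pos _).le

theorem size_sq {b : Periods} (U : Field b) :
    size U ^ 2 = ∑ i, ‖(U.1 i).val‖ ^ 2 + ‖U.2.val‖ ^ 2 :=
  Real.sq_sqrt (add_nonneg (Finset.sum_nonneg fun _ _ => sq_nonneg _) (sq_nonneg _))

/-- The energy is equivalent to the square of the size. -/
theorem exists_energy_equiv (b : Periods) {Pr lam : ℝ} (hPr : 0 < Pr) (hlam : 0 < lam) :
    ∃ m M : ℝ, 0 < m ∧ 0 < M ∧ ∀ U : Field b,
      m * size U ^ 2 ≤ energy Pr lam U ∧ energy Pr lam U ≤ M * size U ^ 2 := by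
  have hp : 0 < lam * Pr / 2 := by positivity
  refine ⟨min (1 / 2) (lam * Pr / 2), max (1 / 2) (lam * Pr / 2), lt_min (by norm_num) hp,
    lt_max_of_lt_right hp, fun U => ?_⟩
  have h1 : 0 ≤ ∑ i, ‖(U.1 i).val‖ ^ 2 := Finset.sum_nonneg fun _ _ => sq_nonneg _
  have h2 := sq_nonneg ‖U.2.val‖
  rw [size_sq, energy, mul_add, mul_add]
  exact ⟨add_le_add (mul_le_mul_of_nonneg_right (min_le_left _ _) h1)
      (mul_le_mul_of_nonneg_right (min_le_right _ _) h2),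
    add_le_add (mul_le_mul_of_nonneg_right (le_max_left _ _) h1)
      (mul_le_mul_of_nonneg_right (le_max_right _ _) h2)⟩

/-- Exponential decay of the energy of all solutions implies global stability. -/
theorem globallyStable_of_energy_decay {b : Periods} {ξ κ Pr R lam r : ℝ} (hPr : 0 < Pr)
    (hlam : 0 < lam) (hr : 0 < r)
    (h : ∀ U : ℝ → Field b, IsSolution ξ κ Pr R U → ∀ t : ℝ, 0 ≤ t →
      energy Pr lam (U t) ≤ Real.exp (-(r * t)) * energy Pr lam (U 0)) :
    GloballyStable b ξ κ Pr R := by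
  obtain ⟨m, M, hm, hM, hE⟩ := exists_energy_equiv b hPr hlam
  have key : ∀ U : ℝ → Field b, IsSolution ξ κ Pr R U → ∀ t : ℝ, 0 ≤ t →
      size (U t) ^ 2 ≤ M / m * Real.exp (-(r * t)) * size (U 0) ^ 2 := fun U hU t ht => by
    have h1 := h U hU t ht
    have h2 := (hE (U t)).1
    have h3 := mul_le_mul_of_nonneg_left (hE (U 0)).2 (Real.exp_pos (-(r * t))).le
    have h4 : size (U t) ^ 2 ≤ (Real.exp (-(r * t)) * (M * size (U 0) ^ 2)) / m := by
      rw [le_div_iff₀ hm]; linarith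
    calc _ ≤ _ := h4
      _ = _ := by ring
  have hL : 0 < M / m := div_pos hM hm
  refine ⟨fun ε hε => ⟨ε / √(M / m), div_pos hε (Real.sqrt_pos.2 hL), fun U hU hδ t ht => ?_⟩,
    fun U hU => ?_⟩
  · have h1 : Real.exp (-(r * t)) ≤ 1 := Real.exp_le_one_iff.2 (by nlinarith)
    have h2 : size (U 0) * √(M / m) < ε := (lt_div_iff₀ (Real.sqrt_pos.2 hL)).1 hδ
    have h3 : size (U t) ^ 2 ≤ (size (U 0) * √(M / m)) ^ 2 := by
      rw [mul_pow, Real.sq_sqrt hL.le]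
      refine (key U hU t ht).trans ?_
      calc M / m * Real.exp (-(r * t)) * size (U 0) ^ 2 ≤ M / m * 1 * size (U 0) ^ 2 := by gcongr
        _ = _ := by ring
    have h0 : 0 ≤ size (U 0) * √(M / m) := mul_nonneg (Real.sqrt_nonneg _) (Real.sqrt_nonneg _)
    exact (pow_le_pow_iff_left₀ (Real.sqrt_nonneg _) h0 two_ne_zero).1 h3 |>.trans_lt h2
  · have h1 : Tendsto (fun t : ℝ => Real.exp (-(r * t))) atTop (𝓝 0) :=
      Real.tendsto_exp_neg_atTop_nhds_zero.comp (tendsto_id.const_mul_atTop hr)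
    have h2 : Tendsto (fun t => size (U t) ^ 2) atTop (𝓝 0) := by
      refine squeeze_zero' (Eventually.of_forall fun t => sq_nonneg _) ?_
        (by simpa using (h1.const_mul (M / m)).mul_const (size (U 0) ^ 2))
      filter_upwards [eventually_ge_atTop 0] with t ht using key U hU t ht
    have h3 := h2.sqrt
    simpa only [Real.sqrt_sq (Real.sqrt_nonneg _), size, Real.sqrt_zero] using h3

theorem decayRate_pos {ξ κ Pr : ℝ} (hξ : 0 < ξ) (hκ : 0 < κ) (hPr : 0 < Pr) :
    0 < decayRate ξ κ Pr := by
  have := Real.pi_pos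
  exact lt_min (by positivity) (by positivity)

theorem production_zero {b : Periods} (κ lam : ℝ) : production κ lam (0 : Field b) = 0 := by
  rw [production_eq]
  have h0 : ∫ x in cell b, profile κ (x 2) * ((0 : Field b).1 2).val x *
      (0 : Field b).2.val x = 0 := by
    refine integral_eq_zero_of_ae ?_
    filter_upwards [Lp.coeFn_zero ℝ 2 (cellMeasure b)] with x hx
    have h1 : (0 : Field b).2.val x = 0 := hx
    rw [h1, mul_zero]
    rfl
  have h1 : inner ℝ (0 : Field b).2.val ((0 : Field b).1 2).val = (0 : ℝ) := inner_zero_left _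
  rw [h0, h1]
  simp

theorem dissipation_zero {b : Periods} (ξ κ lam : ℝ) :
    dissipation ξ κ lam (0 : Field b) = 0 := by
  simpa using dissipation_smul ξ κ lam 0 (0 : Field b)

theorem dissipation_pos {b : Periods} {ξ κ lam : ℝ} (hξ : 0 < ξ) (hκ : 0 < κ) (hlam : 0 < lam)
    {U : Field b} (hU : U ∈ H b) (h0 : U ≠ 0) : 0 < dissipation ξ κ lam U := by
  obtain ⟨c, hc, h⟩ := dissipation_coercive (b := b) hξ hκ hlam
  exact lt_of_lt_of_le (mul_pos hc (pow_pos (norm_pos_iff.2 h0) 2)) (h U hU)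

end Convection

theorem mainTheorem2 (b : Convection.Periods) (ξ κ Pr lam : ℝ)
    (hξ : 0 < ξ) (hκ : 0 < κ) (hPr : 0 < Pr) (hlam : 0 < lam) :
    (∀ U ∈ Convection.H b, U ≠ 0 → 0 < Convection.dissipation ξ κ lam U) ∧
    0 < Convection.RE b ξ κ lam ∧
    IsGreatest (Convection.quotients b ξ κ lam) (1 / Convection.RE b ξ κ lam) ∧
    ∀ R : ℝ, 0 ≤ R →
      (∀ U : ℝ → Convection.Field b, Convection.IsSolution ξ κ Pr R U →
        ∀ᵐ t ∂volume.restrict (Set.Ioi (0 : ℝ)),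
          ∃ e : ℝ, HasDerivAt (fun τ => Convection.energy Pr lam (U τ)) e t ∧
            e = R * Convection.production κ lam (U t) - Convection.dissipation ξ κ lam (U t) ∧
            e ≤ -Convection.dissipation ξ κ lam (U t) * (1 - R / Convection.RE b ξ κ lam) ∧
            (R < Convection.RE b ξ κ lam →
              e ≤ -Convection.decayRate ξ κ Pr * (1 - R / Convection.RE b ξ κ lam)
                * Convection.energy Pr lam (U t))) ∧
      (R < Convection.RE b ξ κ lam →
        (∀ U : ℝ → Convection.Field b, Convection.IsSolution ξ κ Pr R U → ∀ t : ℝ, 0 ≤ t →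
          Convection.energy Pr lam (U t) ≤
            Real.exp (-(Convection.decayRate ξ κ Pr * (1 - R / Convection.RE b ξ κ lam) * t))
              * Convection.energy Pr lam (U 0)) ∧
        Convection.GloballyStable b ξ κ Pr R) := by
  have hDpos : ∀ U ∈ Convection.H b, U ≠ 0 → 0 < Convection.dissipation ξ κ lam U :=
    fun U hU h0 => Convection.dissipation_pos hξ hκ hlam hU h0
  obtain ⟨U₀, hU₀, hU₀0, hpos, hmax⟩ := Convection.exists_max_production b hξ hκ hlam
  have hgreat : IsGreatest (Convection.quotients b ξ κ lam)
      (Convection.production κ lam U₀ / Convection.dissipation ξ κ lam U₀) := by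
    refine ⟨⟨U₀, hU₀, hU₀0, rfl⟩, ?_⟩
    rintro _ ⟨W, hW, hW0, rfl⟩
    exact hmax W hW hW0
  set μ := Convection.production κ lam U₀ / Convection.dissipation ξ κ lam U₀ with hμ
  have hRE : Convection.RE b ξ κ lam = 1 / μ := by
    rw [Convection.RE, hgreat.csSup_eq]
  have hREpos : 0 < Convection.RE b ξ κ lam := by rw [hRE]; positivity
  have hREinv : 1 / Convection.RE b ξ κ lam = μ := by rw [hRE, one_div_one_div]
  have hID : ∀ U ∈ Convection.H b,
      Convection.production κ lam U ≤ μ * Convection.dissipation ξ κ lam U := fun U hU => by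
    by_cases h0 : U = 0
    · rw [h0, Convection.production_zero, Convection.dissipation_zero, mul_zero]
    · exact (div_le_iff₀ (hDpos U hU h0)).1 (hmax U hU h0)
  have henergy : ∀ R : ℝ, 0 ≤ R → ∀ U : ℝ → Convection.Field b,
      Convection.IsSolution ξ κ Pr R U → ∀ᵐ t ∂volume.restrict (Set.Ioi (0 : ℝ)),
        ∃ e : ℝ, HasDerivAt (fun τ => Convection.energy Pr lam (U τ)) e t ∧
          e = R * Convection.production κ lam (U t) - Convection.dissipation ξ κ lam (U t) ∧
          e ≤ -Convection.dissipation ξ κ lam (U t) * (1 - R / Convection.RE b ξ κ lam) ∧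
          (R < Convection.RE b ξ κ lam →
            e ≤ -Convection.decayRate ξ κ Pr * (1 - R / Convection.RE b ξ κ lam)
              * Convection.energy Pr lam (U t)) := by
    intro R hR U hU
    filter_upwards [hU.admissible, hU.equations] with t hadm heq
    obtain ⟨ut, θt, hut, hθt, heqs⟩ := heq
    have hle : R * Convection.production κ lam (U t) - Convection.dissipation ξ κ lam (U t) ≤
        -Convection.dissipation ξ κ lam (U t) * (1 - R / Convection.RE b ξ κ lam) := by
      have h1 := mul_le_mul_of_nonneg_left (hID _ hadm) hR
      rw [div_eq_mul_one_div R, hREinv]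
      linarith
    refine ⟨_, Convection.hasDerivAt_energy Pr lam hut hθt,
      Convection.energy_identity lam hadm heqs, ?_, fun hlt => ?_⟩
    · rw [Convection.energy_identity lam hadm heqs]; exact hle
    · rw [Convection.energy_identity lam hadm heqs]
      have hγ : 0 ≤ 1 - R / Convection.RE b ξ κ lam := by
        rw [sub_nonneg, div_le_one hREpos]; exact hlt.le
      have h2 := mul_le_mul_of_nonneg_right
        (Convection.decayRate_mul_energy_le hξ hκ hPr hlam hadm) hγ
      linarith
  refine ⟨hDpos, hREpos, hREinv.symm ▸ hgreat, fun R hR => ⟨henergy R hR, fun hlt => ?_⟩⟩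
  have hγ : 0 < 1 - R / Convection.RE b ξ κ lam := by
    rw [sub_pos, div_lt_one hREpos]; exact hlt
  have hdecay : ∀ U : ℝ → Convection.Field b, Convection.IsSolution ξ κ Pr R U →
      ∀ t : ℝ, 0 ≤ t → Convection.energy Pr lam (U t) ≤
        Real.exp (-(Convection.decayRate ξ κ Pr * (1 - R / Convection.RE b ξ κ lam) * t))
          * Convection.energy Pr lam (U 0) := by
    intro U hU t ht
    refine Convection.le_exp_mul_of_ae_deriv_le (E := fun τ => Convection.energy Pr lam (U τ))
      (Convection.continuousOn_energy Pr lam hU.cont_u hU.cont_θ)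
      (fun s t hs hst => Convection.absolutelyContinuous_energy Pr lam
        (fun i => hU.ac_u i s t hs hst) (hU.ac_θ s t hs hst)) ?_ ht
    filter_upwards [henergy R hR U hU] with τ hτ
    obtain ⟨e, he, -, -, hle⟩ := hτ
    exact ⟨e, he, by simpa only [neg_mul] using hle hlt⟩
  exact ⟨hdecay, Convection.globallyStable_of_energy_decay hPr hlam
    (mul_pos (Convection.decayRate_pos hξ hκ hPr) hγ) hdecay⟩
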